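/- Let $N\ge 1$, $\nu\in(0,1]$, $\beta_1,\dots,\beta_N>0$ and $\bar\beta=\sum_{i=1}^N\beta_i$. Let $E_{\alpha,\gamma}^{\delta}(z)=\sum_{r\ge 0}\frac{z^r}{\Gamma(\alpha r+\gamma)}\frac{\Gamma(\delta+r)}{r!\,\Gamma(\delta)}$ be the three-parameter Mittag-Leffler function, and for $\lambda,\beta>0$ let $FG(\lambda,\beta,\nu)$ be the law on $(0,\infty)$ with density $\lambda^{\beta}x^{\nu\beta-1}E_{\nu,\nu\beta}^{\beta}(-\lambda x^{\nu})$. Let $\mathrm{Dirichlet}(\beta_1,\dots,\beta_N)$ be the usual Dirichlet law, with density $\frac{\Gamma(\bar\beta)}{\prod_{i}\Gamma(\beta_i)}\prod_{i=1}^N q_i^{\beta_i-1}$ in $(q_1,\dots,q_{N-1})$ on $\{q_1,\dots,q_{N-1}>0,\ q_N:=1-\sum_{i<N}q_i>0\}$. (a) Let $Z_1,\dots,Z_N$ be independent with $Z_i\sim FG(1,\beta_i,\nu)$, $W=Z_1+\dots+Z_N$ and $Q_j=Z_j/W$. Then for every $j=1,\dots,N$ the variable $Q_j$ is square integrable and $$\mathbb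 E\,Q_j=\frac{\beta_j}{\bar\beta},\qquad \operatorname{Var}Q_j=\frac{\beta_j(\bar\beta-\beta_j)}{\bar\beta^2(\bar\beta+1)}\bigl(1+\bar\beta(1-\nu)\bigr).$$ (b) The same holds, for every $j=1,\dots,N-1$, if $(Q_1,\dots,Q_{N-1})$ is any random vector with the fractional Dirichlet density $$\prod_{i=1}^{N}q_i^{\nu\beta_i-1}\int_0^\infty y^{\nu\bar\beta-1}\prod_{i=1}^{N}E_{\nu,\nu\beta_i}^{\beta_i}\bigl(-(yq_i)^\nu\bigr)\,dy,\qquad q_1,\dots,q_{N-1}>0,\quad q_N:=1-\sum_{i<N}q_i>0.$$ (c) The $j$-th marginal of $\mathrm{Dirichlet}(\beta_1,\dots,\beta_N)$ has variance $\frac{\beta_j(\bar\beta-\beta_j)}{\bar\beta^2(\bar\beta+1)}$ for $j=1,\dots,N$. Hence in (a) and (b) the variance of $Q_j$ is at least that of the corresponding Dirichlet marginal, and it is strictly larger if $\nu<1$ and $N\ge 2$ (the marginals are overdispersed). -/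

import Mathlib

open MeasureTheory ProbabilityTheory

noncomputable section

/-- The three-parameter Mittag-Leffler (Prabhakar) function `E_{α,β}^δ(z)`, for real arguments. -/
def mittagLeffler3 (α β δ z : ℝ) : ℝ :=
  ∑' r : ℕ, z ^ r / Real.Gamma (α * r + β) *
    (Real.Gamma (δ + r) / ((r.factorial : ℝ) * Real.Gamma δ))

/-- The density `lam^β x^(νβ-1) E_{ν,νβ}^β(-lam x^ν)`, `x > 0`, of the fractional Gamma law. -/
def fracGammaPDFReal (lam β ν x : ℝ) : ℝ :=
  if 0 < x then
    lam ^ β * x ^ (ν * β - 1) * mittagLeffler3 ν (ν * β) β (-lam * x ^ ν)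
  else 0

/-- The fractional Gamma distribution `FG(lam, β, ν)` on the real line. -/
def fracGammaMeasure (lam β ν : ℝ) : Measure ℝ :=
  volume.withDensity fun x => ENNReal.ofReal (fracGammaPDFReal lam β ν x)

/-- The open simplex `{q | q_i > 0, ∑ q_i < 1}` parametrizing points of the standard simplex
by all their coordinates but the last one. -/
def openSimplex (n : ℕ) : Set (Fin n → ℝ) :=
  {q | (∀ i, 0 < q i) ∧ ∑ i, q i < 1}

/-- The point `(q_1, …, q_n, 1 - ∑ q_i)`. -/
def completeSimplex {n : ℕ} (q : Fin n → ℝ) : Fin (n + 1) → ℝ :=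
  Fin.snoc (α := fun _ => ℝ) q (1 - ∑ i, q i)

open Classical in
/-- The density, in all coordinates but the last one, of the fractional Dirichlet law with
parameters `β` and `ν`. -/
def fracDirichletPDFReal {n : ℕ} (β : Fin (n + 1) → ℝ) (ν : ℝ) (q : Fin n → ℝ) : ℝ :=
  if q ∈ openSimplex n then
    (∏ i, completeSimplex q i ^ (ν * β i - 1)) *
      ∫ y in Set.Ioi (0 : ℝ), y ^ (ν * (∑ i, β i) - 1) *
        ∏ i, mittagLeffler3 ν (ν * β i) (β i) (-(y * completeSimplex q i) ^ ν)
  else 0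

/-- The law of a random vector with density `fracDirichletPDFReal β ν`. -/
def fracDirichletMeasure {n : ℕ} (β : Fin (n + 1) → ℝ) (ν : ℝ) : Measure (Fin n → ℝ) :=
  volume.withDensity fun q => ENNReal.ofReal (fracDirichletPDFReal β ν q)

open Classical in
/-- The density, in all coordinates but the last one, of the classical Dirichlet law. -/
def dirichletPDFReal {n : ℕ} (β : Fin (n + 1) → ℝ) (q : Fin n → ℝ) : ℝ :=
  if q ∈ openSimplex n then
    Real.Gamma (∑ i, β i) / (∏ i, Real.Gamma (β i)) *
      ∏ i, completeSimplex q i ^ (β i - 1)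
  else 0

/-- The classical Dirichlet law, as the law of all coordinates but the last one. -/
def dirichletMeasure {n : ℕ} (β : Fin (n + 1) → ℝ) : Measure (Fin n → ℝ) :=
  volume.withDensity fun q => ENNReal.ofReal (dirichletPDFReal β q)

end

/-!
Write `f` for the density of the fractional Gamma law `FG(1, β, ν)` and `b = ∑ β_i`. Everything
rests on its Laplace transform `∫ e^{-s x} f x dx = (1 + s ^ ν) ^ (-β)`. Granted this,
`1 / W = ∫₀^∞ e^{-s W} ds` and `1 / W ^ 2 = ∫₀^∞ s e^{-s W} ds` turn the first two moments of
`Z_j / W` into integrals over `s` of `(-d/ds) ^ k (1 + s ^ ν) ^ (-β_j)` times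
`(1 + s ^ ν) ^ (-(b - β_j))`, by independence, and these are elementary
(`integral_ratio_fracGammaPi`, `integral_ratio_sq_fracGammaPi`, `variance_ratio_fracGammaPi`).

The series of `f` can be integrated term by term only for `s > 1`
(`integral_exp_mul_fracGammaPDFReal`), and it does not show that `f ≥ 0` or that `f` is
integrable. Both follow from the complete monotonicity of `(1 + s ^ ν) ^ (-β)`, whose signed
derivatives `bernsteinDeriv` are sums of nonnegative functions because `ν ≤ 1`:

* the weights `x ^ n e^{-n x / x₀}` concentrate at `x₀`, and the integrals of `f` against them are
  signed derivatives of the Laplace transform, so `f x₀ ≥ 0`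
  (`nonneg_of_integral_pow_mul_exp_mul_nonneg`);
* since `f ≥ 0`, the integral `∫ e^{-u x} f x dx` is the sum of the Taylor series at `2` of its
  Laplace transform, which is bounded by `(1 + u ^ ν) ^ (-β) ≤ 1` as all remainders are
  nonnegative, so `f` has mass at most `1` (`lintegral_exp_mul_fracGammaPDFReal_le_one`).

Then the Laplace transform is analytic on `s > 0` and the formula extends to all `s > 0`
(`mgf_fracGammaMeasure`); letting `s` tend to `0` shows that `f` has mass exactly `1`.

In the coordinates `y = ∑ z_i`, `q_i = z_i / y` the joint density of the `Z_i` becomes the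
integrand of the fractional Dirichlet density, so the fractional Dirichlet law is the law of the
normalized variables (`map_normalizeInit_fracGammaPi`). For `ν = 1` the Prabhakar function is an
exponential and the fractional Dirichlet law is the Dirichlet law
(`dirichletMeasure_eq_fracDirichletMeasure`), so the Dirichlet variances are the case `ν = 1` of
the general formula.
-/

open Set Filter Topology
open scoped ENNReal

/-! ### The Prabhakar series and the fractional Gamma density -/

/-- The coefficient `Γ(δ + r) / (r! Γ(δ))` of `z ^ r` in the binomial series of
`(1 - z) ^ (-δ)`. -/
noncomputable def prabhakarCoeff (δ : ℝ) (r : ℕ) : ℝ :=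
  Real.Gamma (δ + r) / ((r.factorial : ℝ) * Real.Gamma δ)

lemma prabhakarCoeff_nonneg {δ : ℝ} (hδ : 0 < δ) (r : ℕ) : 0 ≤ prabhakarCoeff δ r := by
  have h1 := Real.Gamma_pos_of_pos hδ
  have h2 : 0 < Real.Gamma (δ + r) := Real.Gamma_pos_of_pos (by positivity)
  unfold prabhakarCoeff
  positivity

lemma Gamma_add_natCast {δ : ℝ} (hδ : 0 < δ) (r : ℕ) :
    Real.Gamma (δ + r) = (ascPochhammer ℝ r).eval δ * Real.Gamma δ := by
  induction r with
  | zero => simp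
  | succ r ih =>
    rw [Nat.cast_succ, ← add_assoc, Real.Gamma_add_one (by positivity), ih,
      ascPochhammer_succ_eval]
    ring

lemma prabhakarCoeff_eq_choose {δ : ℝ} (hδ : 0 < δ) (r : ℕ) :
    prabhakarCoeff δ r = Ring.choose (δ + r - 1) r := by
  have h1 := (Real.Gamma_pos_of_pos hδ).ne'
  have h2 : (r.factorial : ℝ) ≠ 0 := by positivity
  have h3 : (r.factorial : ℝ) * Ring.choose (δ + r - 1) r = (ascPochhammer ℝ r).eval δ := by
    rw [Ring.choose, ← nsmul_eq_mul, show δ + r - 1 - r + 1 = δ by ring,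
      Ring.factorial_nsmul_multichoose_eq_ascPochhammer,
      Polynomial.ascPochhammer_smeval_eq_eval]
  rw [prabhakarCoeff, Gamma_add_natCast hδ, ← h3]
  field_simp

/-- The negative binomial series. -/
lemma hasSum_prabhakarCoeff {δ : ℝ} (hδ : 0 < δ) {u : ℝ} (hu : |u| < 1) :
    HasSum (fun r => prabhakarCoeff δ r * u ^ r) ((1 - u) ^ (-δ)) := by
  have h := (Real.one_div_one_sub_rpow_hasFPowerSeriesOnBall_zero δ).hasSum
    (y := u) (by simpa [enorm_eq_nnnorm, ← NNReal.coe_lt_coe] using hu)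
  have h1 : 0 < 1 - u := by linarith [(abs_lt.1 hu).2]
  rw [Real.rpow_neg h1.le]
  convert! h using 1
  · ext r
    simp [prabhakarCoeff_eq_choose hδ, mul_comm]
  · simp

lemma laplace_rpow {c a s : ℝ} (ha : 0 < a) (hs : 0 < s) :
    ∫ x in Ioi (0:ℝ), Real.exp (-(s * x)) * (c / Real.Gamma a * x ^ (a - 1)) = c * s ^ (-a) := by
  have h := Real.integral_rpow_mul_exp_neg_mul_Ioi ha hs
  have h1 := (Real.Gamma_pos_of_pos ha).ne'
  calc _ = ∫ x in Ioi (0:ℝ), (c / Real.Gamma a) * (x ^ (a - 1) * Real.exp (-(s * x))) := by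
        congr with x; ring
    _ = _ := by
      rw [integral_const_mul, h, one_div, Real.inv_rpow hs.le, ← Real.rpow_neg hs.le]
      field_simp

lemma integrableOn_laplace_rpow {c a s : ℝ} (ha : 0 < a) (hs : 0 < s) :
    IntegrableOn (fun x => Real.exp (-(s * x)) * (c / Real.Gamma a * x ^ (a - 1))) (Ioi 0) := by
  have := (integrableOn_rpow_mul_exp_neg_mul_rpow (s := a - 1) (p := 1) (by linarith) one_pos hs)
  refine IntegrableOn.congr_fun (this.const_mul (c / Real.Gamma a)) (fun x hx => ?_)
    measurableSet_Ioi
  simp; ring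

section Series

variable {α : Type*} [MeasurableSpace α] {μ : Measure α} {F : ℕ → α → ℝ}

lemma lintegral_tsum_enorm_ne_top (hF : ∀ i, Integrable (F i) μ)
    (hs : Summable fun i => ∫ a, ‖F i a‖ ∂μ) : ∫⁻ a, ∑' i, ‖F i a‖ₑ ∂μ ≠ ∞ := by
  rw [lintegral_tsum fun i => (hF i).1.enorm]
  have h (i : ℕ) : ∫⁻ a, ‖F i a‖ₑ ∂μ = ENNReal.ofReal (∫ a, ‖F i a‖ ∂μ) :=
    (ofReal_integral_norm_eq_lintegral_enorm (hF i)).symm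
  simp_rw [h]
  exact hs.tsum_ofReal_ne_top

lemma ae_summable_norm_of_summable_integral_norm (hF : ∀ i, Integrable (F i) μ)
    (hs : Summable fun i => ∫ a, ‖F i a‖ ∂μ) : ∀ᵐ a ∂μ, Summable fun i => ‖F i a‖ := by
  filter_upwards [ae_lt_top' (AEMeasurable.tsum fun i => (hF i).1.enorm)
    (lintegral_tsum_enorm_ne_top hF hs)] with a ha
  have h2 := ENNReal.summable_toReal ha.ne
  simpa using h2

lemma integrable_tsum_of_summable_integral_norm (hF : ∀ i, Integrable (F i) μ)
    (hs : Summable fun i => ∫ a, ‖F i a‖ ∂μ)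
    (hm : AEStronglyMeasurable (fun a => ∑' i, F i a) μ) :
    Integrable (fun a => ∑' i, F i a) μ := by
  refine ⟨hm, lt_of_le_of_lt (lintegral_mono_ae ?_)
    (lintegral_tsum_enorm_ne_top hF hs).lt_top⟩
  filter_upwards [ae_summable_norm_of_summable_integral_norm hF hs] with a ha
  exact enorm_tsum_le_tsum_enorm

end Series

section FracGamma
variable {ν β : ℝ}

/-- The terms of the series of the fractional Gamma density, multiplied by `e^{-s x}`. -/
noncomputable def laplaceTerm (ν β s : ℝ) (r : ℕ) (x : ℝ) : ℝ :=
  Real.exp (-(s * x)) *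
    ((-1) ^ r * prabhakarCoeff β r / Real.Gamma (ν * r + ν * β) * x ^ (ν * r + ν * β - 1))

lemma norm_laplaceTerm (hν : 0 < ν) (hβ : 0 < β) (s : ℝ) (r : ℕ) {x : ℝ} (hx : 0 < x) :
    ‖laplaceTerm ν β s r x‖ = Real.exp (-(s * x)) *
      (prabhakarCoeff β r / Real.Gamma (ν * r + ν * β) * x ^ (ν * r + ν * β - 1)) := by
  have h1 : 0 < Real.Gamma (ν * r + ν * β) := Real.Gamma_pos_of_pos (by positivity)
  have h2 := Real.rpow_pos_of_pos hx (ν * r + ν * β - 1)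
  simp [laplaceTerm, abs_of_pos h1, abs_of_pos h2,
    abs_of_nonneg (prabhakarCoeff_nonneg hβ r)]

lemma integrableOn_laplaceTerm (hν : 0 < ν) (hβ : 0 < β) {s : ℝ} (hs : 0 < s) (r : ℕ) :
    IntegrableOn (laplaceTerm ν β s r) (Ioi 0) :=
  integrableOn_laplace_rpow (by positivity) hs

lemma rpow_neg_mul_add_mul {s : ℝ} (hs : 0 < s) (r : ℕ) :
    s ^ (-(ν * r + ν * β)) = s ^ (-(ν * β)) * (s ^ (-ν)) ^ r := by
  rw [← Real.rpow_natCast, ← Real.rpow_mul hs.le, ← Real.rpow_add hs]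
  ring_nf

lemma summable_integral_norm_laplaceTerm (hν : 0 < ν) (hβ : 0 < β) {s : ℝ} (hs : 1 < s) :
    Summable fun r => ∫ x in Ioi (0:ℝ), ‖laplaceTerm ν β s r x‖ := by
  have h0 : 0 < s := by linarith
  have h (r : ℕ) : ∫ x in Ioi (0:ℝ), ‖laplaceTerm ν β s r x‖ =
      s ^ (-(ν * β)) * (prabhakarCoeff β r * (s ^ (-ν)) ^ r) := by
    rw [setIntegral_congr_fun measurableSet_Ioi
      (fun x hx => norm_laplaceTerm hν hβ s r (mem_Ioi.1 hx)),
      laplace_rpow (by positivity) h0, rpow_neg_mul_add_mul h0]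
    ring
  simp_rw [h]
  refine (hasSum_prabhakarCoeff hβ ?_).summable.mul_left _
  rw [abs_of_pos (Real.rpow_pos_of_pos h0 _)]
  exact Real.rpow_lt_one_of_one_lt_of_neg hs (by linarith)

/-- The series of the Prabhakar function `E_{ν,νβ}^β` converges absolutely everywhere: its terms
are dominated by those of an integrable series, hence it converges at arbitrarily large points. -/
lemma summable_prabhakar (hν : 0 < ν) (hβ : 0 < β) (R : ℝ) :
    Summable fun r : ℕ => ‖R ^ r / Real.Gamma (ν * r + ν * β) * prabhakarCoeff β r‖ := by
  -- any `s > 1` would do in place of `2`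
  have hae := ae_summable_norm_of_summable_integral_norm
    (fun r => integrableOn_laplaceTerm hν hβ two_pos r)
    (summable_integral_norm_laplaceTerm hν hβ one_lt_two)
  rw [ae_restrict_iff' measurableSet_Ioi] at hae
  obtain ⟨T, hT⟩ : ∃ T : ℝ, |R| ≤ T ^ ν ∧ 0 < T := by
    have := (tendsto_rpow_atTop hν).eventually_ge_atTop |R|
    exact (this.and (eventually_gt_atTop 0)).exists
  obtain ⟨x, hxT, hx⟩ : ∃ x, x ∈ Ioi T ∧
      (x ∈ Ioi 0 → Summable fun r => ‖laplaceTerm ν β 2 r x‖) := by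
    have h1 : volume (Ioi T) ≠ 0 := by simp
    exact (frequently_ae_mem_iff.2 h1).and_eventually hae |>.exists
  have hx0 : 0 < x := hT.2.trans hxT
  have hs := (hx hx0).mul_left ((Real.exp (-(2 * x)))⁻¹ * (x ^ (ν * β - 1))⁻¹)
  refine hs.of_nonneg_of_le (fun _ => norm_nonneg _) (fun r => ?_)
  have h1 : 0 < Real.Gamma (ν * r + ν * β) := Real.Gamma_pos_of_pos (by positivity)
  have h3 := prabhakarCoeff_nonneg hβ r
  have h4 : x ^ (ν * r + ν * β - 1) = x ^ (ν * β - 1) * (x ^ ν) ^ r := by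
    rw [← Real.rpow_natCast, ← Real.rpow_mul hx0.le, ← Real.rpow_add hx0]
    ring_nf
  have h5 := Real.rpow_pos_of_pos hx0 (ν * β - 1)
  have h6 : |R| ≤ x ^ ν := hT.1.trans (Real.rpow_le_rpow hT.2.le hxT.le hν.le)
  calc ‖R ^ r / Real.Gamma (ν * r + ν * β) * prabhakarCoeff β r‖
      = |R| ^ r / Real.Gamma (ν * r + ν * β) * prabhakarCoeff β r := by
        simp [abs_of_pos h1, abs_of_nonneg h3]
    _ ≤ (x ^ ν) ^ r / Real.Gamma (ν * r + ν * β) * prabhakarCoeff β r := by gcongr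
    _ = _ := by
        rw [norm_laplaceTerm hν hβ 2 r hx0, h4]
        field_simp

lemma continuous_mittagLeffler3 (hν : 0 < ν) (hβ : 0 < β) :
    Continuous (mittagLeffler3 ν (ν * β) β) := by
  rw [continuous_iff_continuousAt]
  intro z
  have h : ContinuousOn (mittagLeffler3 ν (ν * β) β) (Metric.closedBall 0 (‖z‖ + 1)) := by
    refine continuousOn_tsum (fun r => by fun_prop) (summable_prabhakar hν hβ (‖z‖ + 1)) ?_
    intro r x hx
    rw [mem_closedBall_zero_iff] at hx
    simp only [norm_mul, norm_div, norm_pow, prabhakarCoeff]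
    gcongr
    rw [Real.norm_of_nonneg (by positivity : 0 ≤ ‖z‖ + 1)]
    exact hx
  exact h.continuousAt (Metric.closedBall_mem_nhds_of_mem (by simp))

lemma continuousOn_fracGammaPDFReal (hν : 0 < ν) (hβ : 0 < β) :
    ContinuousOn (fracGammaPDFReal 1 β ν) (Ioi 0) := by
  have h : ContinuousOn (fun x : ℝ => 1 ^ β * x ^ (ν * β - 1) *
      mittagLeffler3 ν (ν * β) β (-1 * x ^ ν)) (Ioi 0) := by
    refine ContinuousOn.mul (continuousOn_const.mul ?_)
      ((continuous_mittagLeffler3 hν hβ).comp_continuousOn (continuousOn_const.mul ?_))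
    all_goals
      exact fun x hx => (Real.continuousAt_rpow_const _ _ (Or.inl hx.ne')).continuousWithinAt
  exact h.congr fun x hx => by simp [fracGammaPDFReal, mem_Ioi.1 hx]

lemma measurable_fracGammaPDFReal (hν : 0 < ν) (hβ : 0 < β) :
    Measurable (fracGammaPDFReal 1 β ν) := by
  have := (continuous_mittagLeffler3 hν hβ).measurable
  unfold fracGammaPDFReal
  exact Measurable.ite measurableSet_Ioi (by fun_prop) measurable_const

lemma tsum_laplaceTerm {s x : ℝ} (hx : 0 < x) :
    ∑' r, laplaceTerm ν β s r x = Real.exp (-(s * x)) * fracGammaPDFReal 1 β ν x := by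
  rw [fracGammaPDFReal, if_pos hx, mittagLeffler3, Real.one_rpow, one_mul, ← tsum_mul_left,
    ← tsum_mul_left]
  congr with r
  have h4 : x ^ (ν * r + ν * β - 1) = x ^ (ν * β - 1) * (x ^ ν) ^ r := by
    rw [← Real.rpow_natCast, ← Real.rpow_mul hx.le, ← Real.rpow_add hx]
    ring_nf
  rw [laplaceTerm, h4, prabhakarCoeff, neg_one_mul, neg_pow (x ^ ν)]
  ring

lemma integrableOn_exp_mul_fracGammaPDFReal (hν : 0 < ν) (hβ : 0 < β) {s : ℝ} (hs : 1 < s) :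
    IntegrableOn (fun x => Real.exp (-(s * x)) * fracGammaPDFReal 1 β ν x) (Ioi 0) := by
  have hm : AEStronglyMeasurable (fun x => ∑' r, laplaceTerm ν β s r x)
      (volume.restrict (Ioi 0)) := by
    refine AEStronglyMeasurable.congr
      (f := fun x => Real.exp (-(s * x)) * fracGammaPDFReal 1 β ν x) ?_ ?_
    · have := measurable_fracGammaPDFReal hν hβ
      exact Measurable.aestronglyMeasurable (by fun_prop)
    · filter_upwards [ae_restrict_mem measurableSet_Ioi] with x hx using (tsum_laplaceTerm hx).symm
  refine IntegrableOn.congr_fun (integrable_tsum_of_summable_integral_norm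
    (fun r => integrableOn_laplaceTerm hν hβ (by linarith) r)
    (summable_integral_norm_laplaceTerm hν hβ hs) hm)
    (fun x hx => tsum_laplaceTerm hx) measurableSet_Ioi

/-- The Laplace transform of the fractional Gamma density, in the range where it can be computed
term by term. -/
lemma integral_exp_mul_fracGammaPDFReal (hν : 0 < ν) (hβ : 0 < β) {s : ℝ} (hs : 1 < s) :
    ∫ x in Ioi (0:ℝ), Real.exp (-(s * x)) * fracGammaPDFReal 1 β ν x = (1 + s ^ ν) ^ (-β) := by
  have h0 : 0 < s := by linarith
  have h := hasSum_integral_of_summable_integral_norm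
    (fun r => integrableOn_laplaceTerm hν hβ h0 r) (summable_integral_norm_laplaceTerm hν hβ hs)
  rw [setIntegral_congr_fun measurableSet_Ioi
    (fun x hx => tsum_laplaceTerm (ν := ν) (β := β) (s := s) (mem_Ioi.1 hx))] at h
  have hu : |-(s ^ (-ν))| < 1 := by
    rw [abs_neg, abs_of_pos (Real.rpow_pos_of_pos h0 _)]
    exact Real.rpow_lt_one_of_one_lt_of_neg hs (by linarith)
  have h2 := (hasSum_prabhakarCoeff hβ hu).mul_left (s ^ (-(ν * β)))
  have h3 : (fun r => ∫ x in Ioi (0:ℝ), laplaceTerm ν β s r x) = fun r =>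
      s ^ (-(ν * β)) * (prabhakarCoeff β r * (-(s ^ (-ν))) ^ r) := by
    ext r
    simp only [laplaceTerm]
    rw [laplace_rpow (by positivity) h0, rpow_neg_mul_add_mul h0, neg_pow (s ^ (-ν))]
    ring
  rw [h3] at h
  rw [h.unique h2, sub_neg_eq_add]
  have h5 : 0 < s ^ (-ν) := Real.rpow_pos_of_pos h0 _
  rw [show -(ν * β) = ν * (-β) by ring, Real.rpow_mul h0.le,
    ← Real.mul_rpow (by positivity) (by positivity), mul_add, ← Real.rpow_add h0]
  simp [add_comm]

end FracGamma

/-! ### Complete monotonicity and positivity of the fractional Gamma density -/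

/-- The function `(-d/ds)^n (s ^ (-a) * (1 + s ^ ν) ^ (-b))`, given by the recursion that
differentiating `s ^ (-a) * (1 + s ^ ν) ^ (-b)` yields. -/
noncomputable def bernsteinDeriv (ν : ℝ) : ℕ → ℝ → ℝ → ℝ → ℝ
  | 0, a, b, s => s ^ (-a) * (1 + s ^ ν) ^ (-b)
  | n + 1, a, b, s =>
    a * bernsteinDeriv ν n (a + 1) b s + b * ν * bernsteinDeriv ν n (a + 1 - ν) (b + 1) s

/-- Complete monotonicity of `s ^ (-a) * (1 + s ^ ν) ^ (-b)`; this is where `ν ≤ 1` enters. -/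
lemma bernsteinDeriv_nonneg {ν : ℝ} (hν0 : 0 ≤ ν) (hν1 : ν ≤ 1) (n : ℕ) {a b s : ℝ} (ha : 0 ≤ a)
    (hb : 0 ≤ b) (hs : 0 < s) : 0 ≤ bernsteinDeriv ν n a b s := by
  induction n generalizing a b with
  | zero => simp only [bernsteinDeriv]; positivity
  | succ n ih =>
    have h1 := ih (a := a + 1) (b := b) (by linarith) hb
    have h2 := ih (a := a + 1 - ν) (b := b + 1) (by linarith) (by linarith)
    simp only [bernsteinDeriv]
    positivity

lemma hasDerivAt_bernsteinDeriv (ν : ℝ) (n : ℕ) (a b : ℝ) {s : ℝ} (hs : 0 < s) :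
    HasDerivAt (bernsteinDeriv ν n a b) (-bernsteinDeriv ν (n + 1) a b s) s := by
  induction n generalizing a b with
  | zero =>
    have h0 : 0 < 1 + s ^ ν := by positivity
    have h1 := Real.hasDerivAt_rpow_const (x := s) (p := -a) (Or.inl hs.ne')
    have h2 := ((Real.hasDerivAt_rpow_const (x := s) (p := ν) (Or.inl hs.ne')).const_add
      1).rpow_const (p := -b) (Or.inl h0.ne')
    have h3 := h1.mul h2
    refine (h3.congr_deriv ?_)
    simp only [bernsteinDeriv]
    rw [show -(a + 1 - ν) = -a + (ν - 1) by ring, Real.rpow_add hs,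
      show -(a + 1) = -a - 1 by ring, show -(b + 1) = -b - 1 by ring]
    ring
  | succ n ih =>
    have h := ((ih (a + 1) b).const_mul a).add ((ih (a + 1 - ν) (b + 1)).const_mul (b * ν))
    refine h.congr_deriv ?_
    rw [show bernsteinDeriv ν (n + 1 + 1) a b s = a * bernsteinDeriv ν (n + 1) (a + 1) b s +
      b * ν * bernsteinDeriv ν (n + 1) (a + 1 - ν) (b + 1) s from rfl]
    ring

section Laplace

variable {f : ℝ → ℝ}

lemma pow_le_factorial_mul_exp {ε x : ℝ} (hε : 0 < ε) (hx : 0 ≤ x) (n : ℕ) :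
    x ^ n ≤ n.factorial / ε ^ n * Real.exp (ε * x) := by
  have h := Real.pow_div_factorial_le_exp (ε * x) (by positivity) n
  rw [div_le_iff₀ (by positivity), mul_pow] at h
  rw [div_mul_eq_mul_div, le_div_iff₀ (by positivity)]
  linarith

lemma integrableOn_pow_mul_exp_mul (hm : Measurable f)
    (hint : ∀ s > 1, IntegrableOn (fun x => Real.exp (-(s * x)) * f x) (Ioi 0))
    (n : ℕ) {s : ℝ} (hs : 1 < s) :
    IntegrableOn (fun x => x ^ n * Real.exp (-(s * x)) * f x) (Ioi 0) := by
  have hε : 0 < (s - 1) / 2 := by linarith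
  refine Integrable.mono' ((hint ((s + 1) / 2) (by linarith)).norm.const_mul
    (n.factorial / ((s - 1) / 2) ^ n)) (Measurable.aestronglyMeasurable (by fun_prop)) ?_
  filter_upwards [ae_restrict_mem measurableSet_Ioi] with x hx
  have hx : 0 < x := hx
  have h := pow_le_factorial_mul_exp hε hx.le n
  rw [norm_mul, norm_mul, norm_mul, Real.norm_of_nonneg (by positivity : 0 ≤ x ^ n),
    Real.norm_of_nonneg (Real.exp_pos _).le, Real.norm_of_nonneg (Real.exp_pos _).le,
    ← mul_assoc]
  refine mul_le_mul_of_nonneg_right ?_ (norm_nonneg _)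
  calc x ^ n * Real.exp (-(s * x))
      ≤ (n.factorial / ((s - 1) / 2) ^ n * Real.exp ((s - 1) / 2 * x)) *
        Real.exp (-(s * x)) := by gcongr
    _ = _ := by
      rw [mul_assoc, ← Real.exp_add]
      congr 2
      ring

lemma hasDerivAt_integral_pow_mul_exp_mul (hm : Measurable f)
    (hint : ∀ s > 1, IntegrableOn (fun x => Real.exp (-(s * x)) * f x) (Ioi 0))
    (n : ℕ) {s : ℝ} (hs : 1 < s) :
    HasDerivAt (fun s => ∫ x in Ioi (0:ℝ), x ^ n * Real.exp (-(s * x)) * f x)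
      (-∫ x in Ioi (0:ℝ), x ^ (n + 1) * Real.exp (-(s * x)) * f x) s := by
  rw [← integral_neg]
  refine (hasDerivAt_integral_of_dominated_loc_of_deriv_le (s := Ioi ((s + 1) / 2))
    (F := fun s x => x ^ n * Real.exp (-(s * x)) * f x)
    (F' := fun s x => -(x ^ (n + 1) * Real.exp (-(s * x)) * f x))
    (bound := fun x => ‖x ^ (n + 1) * Real.exp (-((s + 1) / 2 * x)) * f x‖)
    (Ioi_mem_nhds (by linarith)) ?_ (integrableOn_pow_mul_exp_mul hm hint n hs) ?_ ?_ ?_ ?_).2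
  · exact Eventually.of_forall fun s => Measurable.aestronglyMeasurable (by fun_prop)
  · exact Measurable.aestronglyMeasurable (by fun_prop)
  · filter_upwards [ae_restrict_mem measurableSet_Ioi] with x hx t ht
    have hx : 0 < x := hx
    have ht : (s + 1) / 2 < t := ht
    simp only [norm_neg, norm_mul, Real.norm_eq_abs, Real.abs_exp]
    gcongr
  · exact (integrableOn_pow_mul_exp_mul hm hint (n + 1) (by linarith)).norm
  · filter_upwards with x t ht
    have h : HasDerivAt (fun t : ℝ => Real.exp (-(t * x))) (Real.exp (-(t * x)) * (-x)) t := by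
      have := ((hasDerivAt_id t).mul_const x).neg.exp
      simpa using this
    refine ((h.const_mul (x ^ n)).mul_const (f x)).congr_deriv ?_
    ring

end Laplace

section Widder

/-- The function `u e^{1-u}`, with its strict maximum `1` at `u = 1`. -/
noncomputable def peak (u : ℝ) : ℝ := u * Real.exp (1 - u)

lemma peak_lt_one {u : ℝ} (hu : u ≠ 1) : peak u < 1 := by
  have h := Real.add_one_lt_exp (sub_ne_zero.2 hu)
  have h2 : Real.exp (u - 1) * Real.exp (1 - u) = 1 := by rw [← Real.exp_add]; simp
  have h3 := Real.exp_pos (1 - u)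
  unfold peak
  nlinarith

lemma peak_le_of_le_one {u v : ℝ} (hu : 0 ≤ u) (huv : u ≤ v) (hv : v ≤ 1) : peak u ≤ peak v := by
  have h1 : 1 - (v - u) ≤ Real.exp (-(v - u)) := by
    have := Real.add_one_le_exp (-(v - u)); linarith
  have h2 : Real.exp (-(v - u)) * Real.exp (1 - u) = Real.exp (1 - v) := by
    rw [← Real.exp_add]; ring_nf
  have h3 : u ≤ v * (1 - (v - u)) := by nlinarith
  unfold peak
  rw [← h2, ← mul_assoc]
  have : v * (1 - (v - u)) ≤ v * Real.exp (-(v - u)) := by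
    apply mul_le_mul_of_nonneg_left h1; linarith
  gcongr
  linarith

lemma peak_le_of_one_le {u v : ℝ} (hu : 1 ≤ u) (huv : u ≤ v) : peak v ≤ peak u := by
  have h1 : 1 + (v - u) ≤ Real.exp (v - u) := by
    have := Real.add_one_le_exp (v - u); linarith
  have h2 : Real.exp (v - u) * Real.exp (1 - v) = Real.exp (1 - u) := by
    rw [← Real.exp_add]; ring_nf
  have h3 : v ≤ u * (1 + (v - u)) := by nlinarith
  unfold peak
  rw [← h2, ← mul_assoc]
  have : u * (1 + (v - u)) ≤ u * Real.exp (v - u) := by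
    apply mul_le_mul_of_nonneg_left h1; linarith
  gcongr
  linarith

lemma continuous_peak : Continuous peak := by unfold peak; fun_prop

/-- A form of the Post–Widder inversion theorem: if all derivatives of the Laplace transform of a
continuous function have the signs of those of a completely monotone function, for all large
arguments, then the function is nonnegative. Near a point `x₀` with `f x₀ < 0` the mass of
`(x e^{-x/x₀}) ^ n` concentrates, so that `∫ x ^ n e^{-n x/x₀} f x` is negative for large `n`. -/
lemma nonneg_of_integral_pow_mul_exp_mul_nonneg {f : ℝ → ℝ} (hf : ContinuousOn f (Ioi 0))
    (hint : ∀ (n : ℕ) (s : ℝ), 1 < s →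
      IntegrableOn (fun x => x ^ n * Real.exp (-(s * x)) * f x) (Ioi 0))
    (hpos : ∀ (n : ℕ) (s : ℝ), 1 < s →
      0 ≤ ∫ x in Ioi (0:ℝ), x ^ n * Real.exp (-(s * x)) * f x)
    {x₀ : ℝ} (hx₀ : 0 < x₀) : 0 ≤ f x₀ := by
  by_contra! hneg
  obtain ⟨c, hc, hcf⟩ : ∃ c, 0 < c ∧ f x₀ < -c := ⟨-f x₀ / 2, by linarith, by linarith⟩
  obtain ⟨δ, hδ, hδf⟩ : ∃ δ > 0, ∀ x, |x - x₀| < δ → 0 < x ∧ f x < -c := by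
    have h := (hf.continuousAt (Ioi_mem_nhds hx₀)).eventually_lt_const hcf
    obtain ⟨δ, hδ, h⟩ := Metric.eventually_nhds_iff.1 ((eventually_gt_nhds hx₀).and h)
    exact ⟨δ, hδ, fun x hx => h hx⟩
  have hδx : δ ≤ x₀ := by
    by_contra! h
    have := (hδf 0 (by rwa [zero_sub, abs_neg, abs_of_pos hx₀])).1
    exact lt_irrefl _ this
  -- away from `x₀` the peak function is bounded by some `q < 1`
  obtain ⟨q, hq0, hq1, hq⟩ : ∃ q, 0 < q ∧ q < 1 ∧
      ∀ x, 0 < x → δ ≤ |x - x₀| → peak (x / x₀) ≤ q := by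
    have hd : 0 < δ / x₀ := by positivity
    refine ⟨max (peak (1 - δ / x₀)) (peak (1 + δ / x₀)), lt_max_of_lt_right ?_,
      max_lt (peak_lt_one (by linarith)) (peak_lt_one (by linarith)), fun x hx hxδ => ?_⟩
    · unfold peak; positivity
    · rcases le_abs'.1 hxδ with h | h
      · refine le_max_of_le_left (peak_le_of_le_one (by positivity) ?_ (by linarith))
        rw [div_le_iff₀ hx₀, sub_mul, div_mul_cancel₀ _ hx₀.ne']
        linarith
      · refine le_max_of_le_right (peak_le_of_one_le (by linarith) ?_)
        rw [le_div_iff₀ hx₀, add_mul, div_mul_cancel₀ _ hx₀.ne']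
        linarith
  obtain ⟨q', hqq', hq'1⟩ := exists_between hq1
  have hq'0 : 0 < q' := hq0.trans hqq'
  -- close to `x₀` the peak function is at least `q' > q`
  obtain ⟨η, hη, hηq⟩ : ∃ η > 0, ∀ x, |x - x₀| < η → q' < peak (x / x₀) := by
    have h1 : ContinuousAt (fun x => peak (x / x₀)) x₀ :=
      (continuous_peak.comp (continuous_id.div_const x₀)).continuousAt
    have h2 : q' < peak (x₀ / x₀) := by simpa [div_self hx₀.ne', peak] using hq'1
    obtain ⟨η, hη, h⟩ := Metric.eventually_nhds_iff.1 (h1.eventually_const_lt h2)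
    exact ⟨η, hη, fun x hx => h hx⟩
  set ρ := min η δ with hρdef
  have hρ : 0 < ρ := lt_min hη hδ
  have hpeak (n : ℕ) (x : ℝ) : peak (x / x₀) ^ n * f x =
      (Real.exp 1 / x₀) ^ n * (x ^ n * Real.exp (-(n / x₀ * x)) * f x) := by
    have : Real.exp (-(n / x₀ * x)) = Real.exp (-(x / x₀)) ^ n := by
      rw [← Real.exp_nat_mul]; congr 1; ring
    rw [this, peak, sub_eq_add_neg, Real.exp_add, mul_pow, mul_pow, div_pow, div_pow]
    ring
  -- for `n ≥ m` the argument `n / x₀` of the Laplace transform exceeds `1`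
  obtain ⟨m, hm⟩ := exists_nat_gt x₀
  have hs (k : ℕ) : 1 < ((m + k : ℕ) : ℝ) / x₀ := by
    rw [lt_div_iff₀ hx₀]; push_cast; have : (0:ℝ) ≤ k := k.cast_nonneg; linarith
  have hI (k : ℕ) : IntegrableOn (fun x => peak (x / x₀) ^ (m + k) * f x) (Ioi 0) := by
    simp_rw [hpeak]
    exact (hint _ _ (hs k)).const_mul _
  have hP (k : ℕ) : 0 ≤ ∫ x in Ioi (0:ℝ), peak (x / x₀) ^ (m + k) * f x := by
    simp_rw [hpeak]
    rw [integral_const_mul]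
    exact mul_nonneg (by positivity) (hpos _ _ (hs k))
  set C := ∫ x in Ioi (0:ℝ), ‖peak (x / x₀) ^ (m + 0) * f x‖ with hC
  -- the negative part near `x₀` against the tail, which is a factor `q ^ k` below the integrable
  -- function of the case `k = 0`
  have key (k : ℕ) : c * q' ^ (m + k) * (2 * ρ) ≤ q ^ k * C := by
    have hball : Metric.ball x₀ ρ ⊆ Ioi 0 := fun x hx =>
      (hδf x (lt_of_lt_of_le hx (min_le_right _ _))).1
    have hind : IntegrableOn ((Metric.ball x₀ ρ).indicator fun _ => c * q' ^ (m + k)) (Ioi 0) := by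
      refine (integrable_indicator_iff measurableSet_ball).2 ?_ |>.integrableOn
      exact integrableOn_const measure_ball_lt_top.ne
    have h := setIntegral_mono_on (hI k) (((hI 0).norm.const_mul (q ^ k)).sub hind)
      measurableSet_Ioi (fun x hx => ?_)
    · rw [Pi.sub_def, integral_sub ((hI 0).norm.const_mul (q ^ k)) hind, integral_const_mul,
        setIntegral_indicator measurableSet_ball, inter_eq_self_of_subset_right hball,
        setIntegral_const, ← hC, measureReal_def, Real.volume_ball,
        ENNReal.toReal_ofReal (by positivity), smul_eq_mul] at h
      linarith [hP k]
    · have hx : 0 < x := hx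
      have hp0 : 0 < peak (x / x₀) := by unfold peak; positivity
      simp only [Pi.sub_apply]
      have hr : 0 ≤ q ^ k * ‖peak (x / x₀) ^ (m + 0) * f x‖ := by positivity
      by_cases hxρ : x ∈ Metric.ball x₀ ρ
      · rw [indicator_of_mem hxρ]
        have h1 := (hδf x (lt_of_lt_of_le hxρ (min_le_right _ _))).2
        have h2 := hηq x (lt_of_lt_of_le hxρ (min_le_left _ _))
        have h3 : q' ^ (m + k) ≤ peak (x / x₀) ^ (m + k) := by gcongr
        have h4 : 0 < q' ^ (m + k) := by positivity
        nlinarith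
      · rw [indicator_of_notMem hxρ, sub_zero]
        rcases lt_or_ge |x - x₀| δ with h | h
        · exact (mul_nonpos_of_nonneg_of_nonpos (by positivity)
            (by linarith [(hδf x h).2])).trans hr
        · have h1 : peak (x / x₀) ^ k ≤ q ^ k := by gcongr; exact hq x hx h
          rw [norm_mul, norm_pow, Real.norm_of_nonneg hp0.le, add_zero, pow_add,
            mul_comm (_ ^ m), mul_assoc]
          calc _ ≤ peak (x / x₀) ^ k * (peak (x / x₀) ^ m * ‖f x‖) := by
                gcongr; exact le_abs_self _
            _ ≤ _ := by gcongr
  have h1 : 1 < q' / q := by rwa [one_lt_div hq0]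
  obtain ⟨k, hk⟩ := pow_unbounded_of_one_lt (C / (c * q' ^ m * (2 * ρ))) h1
  rw [div_lt_iff₀ (by positivity), div_pow, div_mul_eq_mul_div, lt_div_iff₀ (by positivity)] at hk
  have := key k
  rw [pow_add] at this
  linarith

end Widder

section Positivity

variable {ν β : ℝ}

lemma integral_pow_mul_exp_mul_fracGammaPDFReal (hν : 0 < ν) (hβ : 0 < β) (n : ℕ) {s : ℝ}
    (hs : 1 < s) :
    ∫ x in Ioi (0:ℝ), x ^ n * Real.exp (-(s * x)) * fracGammaPDFReal 1 β ν x =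
      bernsteinDeriv ν n 0 β s := by
  induction n generalizing s with
  | zero => simpa [bernsteinDeriv] using integral_exp_mul_fracGammaPDFReal hν hβ hs
  | succ n ih =>
    have h1 := hasDerivAt_integral_pow_mul_exp_mul (measurable_fracGammaPDFReal hν hβ)
      (fun s hs => integrableOn_exp_mul_fracGammaPDFReal hν hβ hs) n hs
    have h2 := hasDerivAt_bernsteinDeriv ν n 0 β (by linarith : 0 < s)
    have h3 := h2.congr_of_eventuallyEq ((eventually_gt_nhds hs).mono fun t ht => ih ht)
    exact neg_injective (h1.unique h3)

/-- The fractional Gamma density is nonnegative, since its Laplace transform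
`(1 + s ^ ν) ^ (-β)` is completely monotone. -/
lemma fracGammaPDFReal_nonneg (hν0 : 0 < ν) (hν1 : ν ≤ 1) (hβ : 0 < β) (x : ℝ) :
    0 ≤ fracGammaPDFReal 1 β ν x := by
  rcases le_or_gt x 0 with hx | hx
  · simp [fracGammaPDFReal, hx.not_gt]
  · refine nonneg_of_integral_pow_mul_exp_mul_nonneg (continuousOn_fracGammaPDFReal hν0 hβ)
      (fun n s hs => integrableOn_pow_mul_exp_mul (measurable_fracGammaPDFReal hν0 hβ)
        (fun s hs => integrableOn_exp_mul_fracGammaPDFReal hν0 hβ hs) n hs) (fun n s hs => ?_) hx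
    rw [integral_pow_mul_exp_mul_fracGammaPDFReal hν0 hβ n hs]
    exact bernsteinDeriv_nonneg hν0.le hν1 n le_rfl hβ.le (by linarith)

end Positivity

/-! ### The Laplace transform of the fractional Gamma law -/

/-- The Taylor polynomials of a completely monotone function, expanded to the left, are
dominated by the function, because all remainders are nonnegative. -/
lemma sum_taylor_bernsteinDeriv_le {ν a b s : ℝ} (hν0 : 0 ≤ ν) (hν1 : ν ≤ 1) (ha : 0 ≤ a)
    (hb : 0 ≤ b) (n m : ℕ) {t : ℝ} (ht0 : 0 ≤ t) (hts : t < s) :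
    ∑ k ∈ Finset.range n, t ^ k / k.factorial * bernsteinDeriv ν (m + k) a b s ≤
      bernsteinDeriv ν m a b (s - t) := by
  induction n generalizing m t with
  | zero => simpa using bernsteinDeriv_nonneg hν0 hν1 m ha hb (sub_pos.2 hts)
  | succ n ih =>
    have hder (u : ℝ) (hu : u < s) : HasDerivAt (fun u => bernsteinDeriv ν m a b (s - u) -
        ∑ k ∈ Finset.range (n + 1), u ^ k / k.factorial * bernsteinDeriv ν (m + k) a b s)
        (bernsteinDeriv ν (m + 1) a b (s - u) -
          ∑ k ∈ Finset.range n, u ^ k / k.factorial * bernsteinDeriv ν (m + 1 + k) a b s) u := by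
      refine HasDerivAt.sub ?_ ?_
      · have := (hasDerivAt_bernsteinDeriv ν m a b (sub_pos.2 hu)).comp u
          ((hasDerivAt_id u).const_sub s)
        simpa [Function.comp_def] using this
      · simp_rw [Finset.sum_range_succ']
        simp only [pow_zero]
        refine HasDerivAt.add_const _ (HasDerivAt.fun_sum fun k _ => ?_)
        have := ((hasDerivAt_pow (k + 1) u).div_const ((k + 1).factorial : ℝ)).mul_const
          (bernsteinDeriv ν (m + (k + 1)) a b s)
        refine this.congr_deriv ?_
        rw [Nat.factorial_succ, show m + 1 + k = m + (k + 1) by ring]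
        push_cast
        have h1 : (k : ℝ) + 1 ≠ 0 := by positivity
        have h2 : (k.factorial : ℝ) ≠ 0 := by positivity
        field_simp
    have hmono : MonotoneOn (fun u => bernsteinDeriv ν m a b (s - u) -
        ∑ k ∈ Finset.range (n + 1), u ^ k / k.factorial * bernsteinDeriv ν (m + k) a b s)
        (Icc 0 t) := by
      refine monotoneOn_of_deriv_nonneg (convex_Icc 0 t)
        (fun u hu => (hder u (hu.2.trans_lt hts)).continuousAt.continuousWithinAt)
        (fun u hu => ?_) (fun u hu => ?_)
      all_goals rw [interior_Icc] at hu
      · exact (hder u (hu.2.trans hts)).differentiableAt.differentiableWithinAt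
      · rw [(hder u (hu.2.trans hts)).deriv]
        exact sub_nonneg.2 (ih (m + 1) hu.1.le (hu.2.trans hts))
    have h := hmono (left_mem_Icc.2 ht0) (right_mem_Icc.2 ht0) ht0
    have h0 : ∑ k ∈ Finset.range (n + 1), (0:ℝ) ^ k / k.factorial *
        bernsteinDeriv ν (m + k) a b s = bernsteinDeriv ν m a b s := by
      rw [Finset.sum_range_succ']; simp
    simp only [h0, sub_zero, sub_self] at h
    linarith

section FracGammaMeasure

variable {ν β : ℝ}

lemma bernsteinDeriv_zero_zero (ν β s : ℝ) : bernsteinDeriv ν 0 0 β s = (1 + s ^ ν) ^ (-β) := by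
  simp [bernsteinDeriv]

/-- The Laplace transform of the fractional Gamma density is at most `1` near the origin:
expand `e^{-u x} = e^{-2 x} e^{(2 - u) x}` and compare with the Taylor polynomials at `2`. -/
lemma lintegral_exp_mul_fracGammaPDFReal_le_one (hν0 : 0 < ν) (hν1 : ν ≤ 1) (hβ : 0 < β) {u : ℝ}
    (hu0 : 0 < u) (hu2 : u ≤ 2) :
    ∫⁻ x in Ioi (0:ℝ), ENNReal.ofReal (Real.exp (-(u * x)) * fracGammaPDFReal 1 β ν x) ≤ 1 := by
  have hmeas := measurable_fracGammaPDFReal hν0 hβ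
  have hterm (x : ℝ) (hx : x ∈ Ioi (0:ℝ)) :
      ENNReal.ofReal (Real.exp (-(u * x)) * fracGammaPDFReal 1 β ν x) =
      ∑' k : ℕ, ENNReal.ofReal ((2 - u) ^ k / k.factorial *
        (x ^ k * Real.exp (-(2 * x)) * fracGammaPDFReal 1 β ν x)) := by
    have hx : 0 < x := hx
    have h2u : 0 ≤ 2 - u := by linarith
    have hf := fracGammaPDFReal_nonneg hν0 hν1 hβ x
    have h := (NormedSpace.expSeries_div_hasSum_exp ((2 - u) * x)).mul_right
      (Real.exp (-(2 * x)) * fracGammaPDFReal 1 β ν x)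
    rw [← Real.exp_eq_exp_ℝ, ← mul_assoc, ← Real.exp_add,
      show (2 - u) * x + -(2 * x) = -(u * x) by ring] at h
    have h' : (fun k : ℕ => ((2 - u) * x) ^ k / k.factorial *
        (Real.exp (-(2 * x)) * fracGammaPDFReal 1 β ν x)) = fun k : ℕ =>
        (2 - u) ^ k / k.factorial *
        (x ^ k * Real.exp (-(2 * x)) * fracGammaPDFReal 1 β ν x) := by
      ext k; rw [mul_pow]; ring
    rw [h'] at h
    rw [← h.tsum_eq, ENNReal.ofReal_tsum_of_nonneg (fun k => by positivity) h.summable]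
  rw [setLIntegral_congr_fun measurableSet_Ioi hterm, lintegral_tsum (fun k => by fun_prop)]
  refine ENNReal.tsum_le_of_sum_range_le fun n => ?_
  have hk (k : ℕ) : ∫⁻ x in Ioi (0:ℝ), ENNReal.ofReal ((2 - u) ^ k / k.factorial *
      (x ^ k * Real.exp (-(2 * x)) * fracGammaPDFReal 1 β ν x)) =
      ENNReal.ofReal ((2 - u) ^ k / k.factorial * bernsteinDeriv ν (0 + k) 0 β 2) := by
    have h2u : 0 ≤ 2 - u := by linarith
    rw [← ofReal_integral_eq_lintegral_ofReal, integral_const_mul,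
      integral_pow_mul_exp_mul_fracGammaPDFReal hν0 hβ k one_lt_two, zero_add]
    · exact (integrableOn_pow_mul_exp_mul hmeas
        (fun s hs => integrableOn_exp_mul_fracGammaPDFReal hν0 hβ hs) k one_lt_two).const_mul _
    · filter_upwards [ae_restrict_mem measurableSet_Ioi] with x hx
      have hx : 0 < x := hx
      have hf := fracGammaPDFReal_nonneg hν0 hν1 hβ x
      simp only [Pi.zero_apply]
      positivity
  simp_rw [hk]
  rw [← ENNReal.ofReal_sum_of_nonneg]
  · rw [← ENNReal.ofReal_one]
    refine ENNReal.ofReal_le_ofReal ((sum_taylor_bernsteinDeriv_le hν0.le hν1 le_rfl hβ.le n 0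
      (by linarith) (by linarith)).trans ?_)
    rw [bernsteinDeriv_zero_zero, sub_sub_cancel]
    have h1 : 0 < u ^ ν := by positivity
    exact Real.rpow_le_one_of_one_le_of_nonpos (by linarith) (by linarith)
  · intro k _
    have h2u : 0 ≤ 2 - u := by linarith
    have := bernsteinDeriv_nonneg hν0.le hν1 (0 + k) le_rfl hβ.le (two_pos (α := ℝ))
    positivity

lemma lintegral_fracGammaMeasure (hν : 0 < ν) (hβ : 0 < β) {g : ℝ → ℝ≥0∞} (hg : Measurable g) :
    ∫⁻ x, g x ∂fracGammaMeasure 1 β ν =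
      ∫⁻ x in Ioi (0:ℝ), ENNReal.ofReal (fracGammaPDFReal 1 β ν x) * g x := by
  have hm := measurable_fracGammaPDFReal hν hβ
  rw [fracGammaMeasure, lintegral_withDensity_eq_lintegral_mul _ (by fun_prop) hg,
    ← lintegral_indicator measurableSet_Ioi]
  congr with x
  by_cases hx : 0 < x
  · rw [indicator_of_mem (mem_Ioi.2 hx)]; rfl
  · rw [indicator_of_notMem (by simpa using hx)]
    simp [fracGammaPDFReal, hx]

lemma ae_pos_fracGammaMeasure (hν : 0 < ν) (hβ : 0 < β) :
    ∀ᵐ x ∂fracGammaMeasure 1 β ν, 0 < x := by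
  have hm := measurable_fracGammaPDFReal hν hβ
  refine (ae_withDensity_iff (by fun_prop)).2 (Eventually.of_forall fun x hx => ?_)
  by_contra h
  exact hx (by simp [fracGammaPDFReal, h])

lemma fracGammaMeasure_univ_le_one (hν0 : 0 < ν) (hν1 : ν ≤ 1) (hβ : 0 < β) :
    fracGammaMeasure 1 β ν univ ≤ 1 := by
  have hm := measurable_fracGammaPDFReal hν0 hβ
  rw [← lintegral_one, lintegral_fracGammaMeasure hν0 hβ measurable_const]
  simp only [mul_one]
  have ht := lintegral_tendsto_of_tendsto_of_monotone (μ := volume.restrict (Ioi (0:ℝ)))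
    (f := fun (n : ℕ) x =>
      ENNReal.ofReal (Real.exp (-(1 / ((n : ℝ) + 1) * x)) * fracGammaPDFReal 1 β ν x))
    (F := fun x => ENNReal.ofReal (fracGammaPDFReal 1 β ν x)) (fun n => by fun_prop) ?_ ?_
  · refine le_of_tendsto' ht fun n => ?_
    refine lintegral_exp_mul_fracGammaPDFReal_le_one hν0 hν1 hβ (by positivity) ?_
    have : (0:ℝ) ≤ n := n.cast_nonneg
    rw [div_le_iff₀ (by positivity)]; linarith
  · filter_upwards [ae_restrict_mem measurableSet_Ioi] with x hx n k hnk
    have hx : 0 < x := hx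
    have hf := fracGammaPDFReal_nonneg hν0 hν1 hβ x
    dsimp only
    gcongr
  · filter_upwards with x
    refine ENNReal.tendsto_ofReal ?_
    have h1 : Tendsto (fun n : ℕ => Real.exp (-(1 / ((n : ℝ) + 1) * x))) atTop (𝓝 1) := by
      have := (tendsto_one_div_add_atTop_nhds_zero_nat (𝕜 := ℝ)).mul_const x
      simpa [Function.comp_def] using (Real.continuous_exp.tendsto _).comp this.neg
    simpa using h1.mul_const (fracGammaPDFReal 1 β ν x)

lemma isFiniteMeasure_fracGammaMeasure (hν0 : 0 < ν) (hν1 : ν ≤ 1) (hβ : 0 < β) :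
    IsFiniteMeasure (fracGammaMeasure 1 β ν) :=
  ⟨(fracGammaMeasure_univ_le_one hν0 hν1 hβ).trans_lt ENNReal.one_lt_top⟩

lemma Iio_subset_interior_integrableExpSet (hν0 : 0 < ν) (hν1 : ν ≤ 1) (hβ : 0 < β) :
    Iio 0 ⊆ interior (integrableExpSet id (fracGammaMeasure 1 β ν)) := by
  have := isFiniteMeasure_fracGammaMeasure hν0 hν1 hβ
  refine interior_maximal (fun t ht => ?_) isOpen_Iio
  have ht : t < 0 := ht
  refine Integrable.of_bound (Measurable.aestronglyMeasurable (by fun_prop)) 1 ?_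
  filter_upwards [ae_pos_fracGammaMeasure hν0 hβ] with x hx
  rw [Real.norm_of_nonneg (Real.exp_pos _).le, Real.exp_le_one_iff]
  exact mul_nonpos_of_nonpos_of_nonneg ht.le hx.le

/-- The Laplace transform of the fractional Gamma law. The two sides agree for large arguments
and are real analytic. -/
lemma mgf_fracGammaMeasure (hν0 : 0 < ν) (hν1 : ν ≤ 1) (hβ : 0 < β) {t : ℝ} (ht : t < 0) :
    mgf id (fracGammaMeasure 1 β ν) t = (1 + (-t) ^ ν) ^ (-β) := by
  have hm := measurable_fracGammaPDFReal hν0 hβ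
  have h1 : AnalyticOnNhd ℝ (mgf id (fracGammaMeasure 1 β ν)) (Iio 0) :=
    analyticOnNhd_mgf.mono (Iio_subset_interior_integrableExpSet hν0 hν1 hβ)
  have h2 : AnalyticOnNhd ℝ (fun t : ℝ => (1 + (-t) ^ ν) ^ (-β)) (Iio 0) := by
    intro t ht
    have ht : 0 < -t := neg_pos.2 ht
    have h3 : 0 < 1 + (-t) ^ ν := by positivity
    refine ContDiffAt.analyticAt ?_
    exact (contDiffAt_const.add (contDiffAt_id.neg.rpow_const_of_ne ht.ne')).rpow_const_of_ne h3.ne'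
  refine h1.eqOn_of_preconnected_of_eventuallyEq h2 isPreconnected_Iio
    (z₀ := -2) (by simp) ?_ ht
  filter_upwards [Iio_mem_nhds (show (-2:ℝ) < -1 by norm_num)] with u hu
  have hu : 1 < -u := by rw [mem_Iio] at hu; linarith
  rw [← integral_exp_mul_fracGammaPDFReal hν0 hβ hu, mgf,
    integral_eq_lintegral_of_nonneg_ae (Eventually.of_forall fun x => (Real.exp_pos _).le)
      (Measurable.aestronglyMeasurable (by fun_prop)),
    integral_eq_lintegral_of_nonneg_ae (Eventually.of_forall fun x =>
      mul_nonneg (Real.exp_pos _).le (fracGammaPDFReal_nonneg hν0 hν1 hβ x))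
      (Measurable.aestronglyMeasurable (by fun_prop)),
    lintegral_fracGammaMeasure hν0 hβ (by fun_prop)]
  congr 2 with x
  rw [← ENNReal.ofReal_mul (fracGammaPDFReal_nonneg hν0 hν1 hβ x), mul_comm]
  simp

lemma integral_pow_mul_exp_fracGammaMeasure (hν0 : 0 < ν) (hν1 : ν ≤ 1) (hβ : 0 < β) (n : ℕ)
    {s : ℝ} (hs : 0 < s) :
    ∫ x, x ^ n * Real.exp (-(s * x)) ∂fracGammaMeasure 1 β ν = bernsteinDeriv ν n 0 β s := by
  induction n generalizing s with
  | zero =>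
    have := mgf_fracGammaMeasure hν0 hν1 hβ (neg_lt_zero.2 hs)
    simpa [mgf, bernsteinDeriv] using this
  | succ n ih =>
    have h1 := (hasDerivAt_integral_pow_mul_exp_real
      (Iio_subset_interior_integrableExpSet hν0 hν1 hβ (neg_lt_zero.2 hs)) n).comp s
      (hasDerivAt_neg s)
    have h2 := (hasDerivAt_bernsteinDeriv ν n 0 β hs).congr_of_eventuallyEq
      ((eventually_gt_nhds hs).mono fun t ht => ih ht)
    have h3 : HasDerivAt (fun s => ∫ x, x ^ n * Real.exp (-(s * x)) ∂fracGammaMeasure 1 β ν)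
      (-∫ x, x ^ (n + 1) * Real.exp (-(s * x)) ∂fracGammaMeasure 1 β ν) s := by
      simpa [Function.comp_def] using h1
    exact neg_injective (h3.unique h2)

lemma isProbabilityMeasure_fracGammaMeasure (hν0 : 0 < ν) (hν1 : ν ≤ 1) (hβ : 0 < β) :
    IsProbabilityMeasure (fracGammaMeasure 1 β ν) := by
  have := isFiniteMeasure_fracGammaMeasure hν0 hν1 hβ
  -- let the argument of the Laplace transform tend to `0`
  have hu : Tendsto (fun n : ℕ => 1 / ((n : ℝ) + 1)) atTop (𝓝 0) :=
    tendsto_one_div_add_atTop_nhds_zero_nat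
  have h1 : Tendsto (fun n : ℕ =>
      ∫ x, Real.exp (-(1 / ((n : ℝ) + 1) * x)) ∂fracGammaMeasure 1 β ν) atTop
      (𝓝 (∫ _, 1 ∂fracGammaMeasure 1 β ν)) := by
    refine tendsto_integral_filter_of_norm_le_const
      (Eventually.of_forall fun n => Measurable.aestronglyMeasurable (by fun_prop))
      ⟨1, Eventually.of_forall fun n => ?_⟩ (Eventually.of_forall fun x => ?_)
    · filter_upwards [ae_pos_fracGammaMeasure hν0 hβ] with x hx
      rw [Real.norm_of_nonneg (Real.exp_pos _).le, Real.exp_le_one_iff, neg_nonpos]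
      positivity
    · simpa [Function.comp_def] using (Real.continuous_exp.tendsto _).comp (hu.mul_const x).neg
  have h2 : Tendsto (fun n : ℕ => (1 + (1 / ((n : ℝ) + 1)) ^ ν) ^ (-β)) atTop (𝓝 1) := by
    have h3 := ((Real.continuousAt_rpow_const 0 ν (Or.inr hν0.le)).tendsto.comp hu).const_add 1
    rw [Real.zero_rpow hν0.ne', add_zero] at h3
    simpa [Function.comp_def] using
      (Real.continuousAt_rpow_const 1 (-β) (Or.inl one_ne_zero)).tendsto.comp h3
  have h3 (n : ℕ) : ∫ x, Real.exp (-(1 / ((n : ℝ) + 1) * x)) ∂fracGammaMeasure 1 β ν =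
      (1 + (1 / ((n : ℝ) + 1)) ^ ν) ^ (-β) := by
    rw [← bernsteinDeriv_zero_zero,
      ← integral_pow_mul_exp_fracGammaMeasure hν0 hν1 hβ 0 (by positivity)]
    simp
  simp_rw [h3] at h1
  have h4 := tendsto_nhds_unique h1 h2
  simp only [integral_const, smul_eq_mul, mul_one] at h4
  exact (isProbabilityMeasure_iff_real).2 h4

end FracGammaMeasure

/-! ### Moments of normalized independent fractional Gamma variables -/

section BetaIntegral

variable {ν b : ℝ}

lemma integrableOn_and_integral_rpow_mul_one_add_rpow (hν : 0 < ν) (hb : 0 < b) :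
    IntegrableOn (fun s : ℝ => ν * s ^ (ν - 1) * (1 + s ^ ν) ^ (-(b + 1))) (Ioi 0) ∧
      ∫ s in Ioi (0:ℝ), ν * s ^ (ν - 1) * (1 + s ^ ν) ^ (-(b + 1)) = 1 / b := by
  have hcont : ContinuousWithinAt (fun s : ℝ => -(1 / b) * (1 + s ^ ν) ^ (-b)) (Ici 0) 0 := by
    have h1 : ContinuousAt (fun s : ℝ => 1 + s ^ ν) 0 :=
      continuousAt_const.add (Real.continuousAt_rpow_const 0 ν (Or.inr hν.le))
    exact (continuousAt_const.mul (h1.rpow_const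
      (Or.inl (by simp [Real.zero_rpow hν.ne'])))).continuousWithinAt
  have hder : ∀ s ∈ Ioi (0:ℝ), HasDerivAt (fun s : ℝ => -(1 / b) * (1 + s ^ ν) ^ (-b))
      (ν * s ^ (ν - 1) * (1 + s ^ ν) ^ (-(b + 1))) s := by
    intro s hs
    have hs : 0 < s := hs
    have h0 : 0 < 1 + s ^ ν := by positivity
    have h2 := (((Real.hasDerivAt_rpow_const (x := s) (p := ν) (Or.inl hs.ne')).const_add
      1).rpow_const (p := -b) (Or.inl h0.ne')).const_mul (-(1 / b))
    refine h2.congr_deriv ?_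
    rw [show -(b + 1) = -b - 1 by ring]
    field_simp
  have hnn : ∀ s ∈ Ioi (0:ℝ), 0 ≤ ν * s ^ (ν - 1) * (1 + s ^ ν) ^ (-(b + 1)) := by
    intro s hs
    have hs : 0 < s := hs
    positivity
  have hlim : Tendsto (fun s : ℝ => -(1 / b) * (1 + s ^ ν) ^ (-b)) atTop (𝓝 0) := by
    have h1 : Tendsto (fun s : ℝ => 1 + s ^ ν) atTop atTop :=
      tendsto_atTop_add_const_left _ _ (tendsto_rpow_atTop hν)
    simpa using ((tendsto_rpow_neg_atTop hb).comp h1).const_mul (-(1 / b))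
  refine ⟨integrableOn_Ioi_deriv_of_nonneg hcont hder hnn hlim, ?_⟩
  rw [integral_Ioi_of_hasDerivAt_of_nonneg hcont hder hnn hlim]
  simp [Real.zero_rpow hν.ne']

lemma integrableOn_and_integral_rpow_two_mul_one_add_rpow (hν : 0 < ν) (hb : 0 < b) :
    IntegrableOn (fun s : ℝ => ν * s ^ (2 * ν - 1) * (1 + s ^ ν) ^ (-(b + 2))) (Ioi 0) ∧
      ∫ s in Ioi (0:ℝ), ν * s ^ (2 * ν - 1) * (1 + s ^ ν) ^ (-(b + 2)) = 1 / (b * (b + 1)) := by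
  obtain ⟨h1, h1'⟩ := integrableOn_and_integral_rpow_mul_one_add_rpow hν hb
  obtain ⟨h2, h2'⟩ := integrableOn_and_integral_rpow_mul_one_add_rpow hν (by linarith : 0 < b + 1)
  have h : EqOn ((fun s : ℝ => ν * s ^ (ν - 1) * (1 + s ^ ν) ^ (-(b + 1))) -
      fun s : ℝ => ν * s ^ (ν - 1) * (1 + s ^ ν) ^ (-(b + 1 + 1)))
      (fun s : ℝ => ν * s ^ (2 * ν - 1) * (1 + s ^ ν) ^ (-(b + 2))) (Ioi 0) := by
    intro s hs
    have hs : 0 < s := hs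
    have h0 : 0 < 1 + s ^ ν := by positivity
    simp only [Pi.sub_apply]
    rw [show 2 * ν - 1 = ν + (ν - 1) by ring, Real.rpow_add hs,
      show -(b + 1) = 1 + -(b + 2) by ring, Real.rpow_add h0 1, Real.rpow_one,
      show b + 1 + 1 = b + 2 by ring]
    ring
  refine ⟨(h1.sub h2).congr_fun h measurableSet_Ioi, ?_⟩
  rw [← setIntegral_congr_fun measurableSet_Ioi h, Pi.sub_def, integral_sub h1 h2, h1', h2']
  field_simp
  ring

end BetaIntegral

section Moments

variable {ι : Type*} [Fintype ι] {ν : ℝ} {β : ι → ℝ}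

/-- The joint law of independent fractional Gamma variables `FG(1, β i, ν)`. -/
noncomputable def fracGammaPi (β : ι → ℝ) (ν : ℝ) : Measure (ι → ℝ) :=
  Measure.pi fun i => fracGammaMeasure 1 (β i) ν

lemma isProbabilityMeasure_fracGammaPi (hν0 : 0 < ν) (hν1 : ν ≤ 1) (hβ : ∀ i, 0 < β i) :
    IsProbabilityMeasure (fracGammaPi β ν) := by
  have (i : ι) := isProbabilityMeasure_fracGammaMeasure hν0 hν1 (hβ i)
  unfold fracGammaPi
  infer_instance

lemma ae_pos_fracGammaPi (hν0 : 0 < ν) (hν1 : ν ≤ 1) (hβ : ∀ i, 0 < β i) :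
    ∀ᵐ z ∂fracGammaPi β ν, ∀ i, 0 < z i := by
  have (i : ι) := isProbabilityMeasure_fracGammaMeasure hν0 hν1 (hβ i)
  rw [ae_all_iff]
  intro i
  exact (measurePreserving_eval (fun i => fracGammaMeasure 1 (β i) ν) i).quasiMeasurePreserving.ae
    (ae_pos_fracGammaMeasure hν0 (hβ i))

lemma lintegral_pow_mul_exp_sum_fracGammaPi (hν0 : 0 < ν) (hν1 : ν ≤ 1) (hβ : ∀ i, 0 < β i)
    (j : ι) (k : ℕ) {s : ℝ} (hs : 0 < s) :
    ∫⁻ z, ENNReal.ofReal (z j ^ k * Real.exp (-(s * ∑ i, z i))) ∂fracGammaPi β ν =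
      ENNReal.ofReal (bernsteinDeriv ν k 0 (β j) s * (1 + s ^ ν) ^ (-(∑ i, β i - β j))) := by
  classical
  have (i : ι) := isProbabilityMeasure_fracGammaMeasure hν0 hν1 (hβ i)
  -- one factor for each coordinate, so that the integral over the product measure factors
  have hsplit (z : ι → ℝ) : z j ^ k * Real.exp (-(s * ∑ i, z i)) =
      ∏ i, z i ^ (if i = j then k else 0) * Real.exp (-(s * z i)) := by
    rw [Finset.prod_mul_distrib, ← Real.exp_sum, Finset.sum_neg_distrib, Finset.mul_sum]
    simp [pow_ite]
  have hint (i : ι) (m : ℕ) :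
      Integrable (fun x => x ^ m * Real.exp (-(s * x))) (fracGammaMeasure 1 (β i) ν) := by
    have := integrable_pow_mul_exp_of_mem_interior_integrableExpSet
      (Iio_subset_interior_integrableExpSet hν0 hν1 (hβ i) (neg_lt_zero.2 hs)) m
    simpa using this
  have h0 : 0 < 1 + s ^ ν := by positivity
  rw [← ofReal_integral_eq_lintegral_ofReal]
  · congr 1
    simp_rw [hsplit]
    rw [fracGammaPi, integral_fintype_prod_eq_prod
      (fun i (x : ℝ) => x ^ (if i = j then k else 0) * Real.exp (-(s * x))),
      ← Finset.mul_prod_erase _ _ (Finset.mem_univ j)]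
    simp_rw [integral_pow_mul_exp_fracGammaMeasure hν0 hν1 (hβ _) _ hs]
    rw [if_pos trivial, ← Finset.sum_erase_eq_sub (Finset.mem_univ j), ← Finset.sum_neg_distrib,
      Real.rpow_sum_of_pos h0]
    congr 1
    refine Finset.prod_congr rfl fun i hi => ?_
    rw [if_neg (Finset.ne_of_mem_erase hi), bernsteinDeriv_zero_zero]
  · simp_rw [hsplit]
    exact Integrable.fintype_prod_dep
      (f := fun i (x : ℝ) => x ^ (if i = j then k else 0) * Real.exp (-(s * x)))
      (fun i => hint i _)
  · filter_upwards [ae_pos_fracGammaPi hν0 hν1 hβ] with z hz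
    have := hz j
    simp only [Pi.zero_apply]
    positivity

/-- `(a / w) ^ (k + 1) = ∫₀^∞ (s ^ k / k!) a ^ (k + 1) e^{-s w} ds`. -/
lemma ofReal_div_pow_eq_lintegral (k : ℕ) {a w : ℝ} (ha : 0 ≤ a) (hw : 0 < w) :
    ENNReal.ofReal ((a / w) ^ (k + 1)) = ∫⁻ s in Ioi (0:ℝ),
      ENNReal.ofReal (s ^ k / k.factorial) *
        ENNReal.ofReal (a ^ (k + 1) * Real.exp (-(s * w))) := by
  have hk : (0:ℝ) < k + 1 := by positivity
  have h1 := Real.integral_rpow_mul_exp_neg_mul_Ioi hk hw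
  have h2 := integrableOn_rpow_mul_exp_neg_mul_rpow (s := (k + 1 : ℝ) - 1) (p := 1)
    (by linarith) one_pos hw
  have heq : EqOn (fun s : ℝ => a ^ (k + 1) / k.factorial * (s ^ ((k + 1 : ℝ) - 1) *
      Real.exp (-(w * s))))
      (fun s => s ^ k / k.factorial * (a ^ (k + 1) * Real.exp (-(s * w)))) (Ioi 0) := by
    intro s _
    simp only [add_sub_cancel_right, Real.rpow_natCast]
    ring_nf
  have h3 : IntegrableOn (fun s : ℝ => a ^ (k + 1) / k.factorial * (s ^ ((k + 1 : ℝ) - 1) *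
      Real.exp (-(w * s)))) (Ioi 0) := by
    refine Integrable.const_mul ?_ _
    simpa [IntegrableOn] using h2
  have h4 : ∫ s in Ioi (0:ℝ), s ^ k / k.factorial * (a ^ (k + 1) * Real.exp (-(s * w))) =
      (a / w) ^ (k + 1) := by
    rw [← setIntegral_congr_fun measurableSet_Ioi heq, integral_const_mul, h1,
      Real.Gamma_nat_eq_factorial, ← Nat.cast_succ, Real.rpow_natCast]
    simp only [Nat.succ_eq_add_one, div_pow, one_pow]
    field_simp
  rw [← h4, ofReal_integral_eq_lintegral_ofReal (h3.congr_fun heq measurableSet_Ioi)]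
  · refine setLIntegral_congr_fun measurableSet_Ioi fun s hs => ?_
    have hs : 0 < s := hs
    exact ENNReal.ofReal_mul (by positivity)
  · filter_upwards [ae_restrict_mem measurableSet_Ioi] with s hs
    have hs : 0 < s := hs
    simp only [Pi.zero_apply]
    positivity

lemma lintegral_ratio_pow_fracGammaPi (hν0 : 0 < ν) (hν1 : ν ≤ 1) (hβ : ∀ i, 0 < β i)
    (j : ι) (k : ℕ) :
    ∫⁻ z, ENNReal.ofReal ((z j / ∑ i, z i) ^ (k + 1)) ∂fracGammaPi β ν =
      ∫⁻ s in Ioi (0:ℝ), ENNReal.ofReal (s ^ k / k.factorial *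
        (bernsteinDeriv ν (k + 1) 0 (β j) s * (1 + s ^ ν) ^ (-(∑ i, β i - β j)))) := by
  have := isProbabilityMeasure_fracGammaPi hν0 hν1 hβ
  have h1 : ∫⁻ z, ENNReal.ofReal ((z j / ∑ i, z i) ^ (k + 1)) ∂fracGammaPi β ν =
      ∫⁻ z, (∫⁻ s in Ioi (0:ℝ), ENNReal.ofReal (s ^ k / k.factorial) *
        ENNReal.ofReal (z j ^ (k + 1) * Real.exp (-(s * ∑ i, z i)))) ∂fracGammaPi β ν := by
    refine lintegral_congr_ae ?_
    filter_upwards [ae_pos_fracGammaPi hν0 hν1 hβ] with z hz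
    exact ofReal_div_pow_eq_lintegral k (hz j).le
      (Finset.sum_pos (fun i _ => hz i) ⟨j, Finset.mem_univ j⟩)
  rw [h1, lintegral_lintegral_swap (by fun_prop)]
  refine setLIntegral_congr_fun measurableSet_Ioi fun s hs => ?_
  have hs : 0 < s := hs
  rw [lintegral_const_mul _ (by fun_prop),
    lintegral_pow_mul_exp_sum_fracGammaPi hν0 hν1 hβ j (k + 1) hs,
    ← ENNReal.ofReal_mul (by positivity)]

lemma ae_ratio_mem_Icc_fracGammaPi (hν0 : 0 < ν) (hν1 : ν ≤ 1) (hβ : ∀ i, 0 < β i) (j : ι) :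
    ∀ᵐ z ∂fracGammaPi β ν, z j / ∑ i, z i ∈ Icc 0 1 := by
  filter_upwards [ae_pos_fracGammaPi hν0 hν1 hβ] with z hz
  have h : 0 < ∑ i, z i := Finset.sum_pos (fun i _ => hz i) ⟨j, Finset.mem_univ j⟩
  exact ⟨div_nonneg (hz j).le h.le, (div_le_one h).2
    (Finset.single_le_sum (fun i _ => (hz i).le) (Finset.mem_univ j))⟩

lemma memLp_ratio_fracGammaPi (hν0 : 0 < ν) (hν1 : ν ≤ 1) (hβ : ∀ i, 0 < β i) (j : ι)
    (p : ℝ≥0∞) : MemLp (fun z => z j / ∑ i, z i) p (fracGammaPi β ν) := by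
  have := isProbabilityMeasure_fracGammaPi hν0 hν1 hβ
  refine MemLp.of_bound (Measurable.aestronglyMeasurable (by fun_prop)) 1 ?_
  filter_upwards [ae_ratio_mem_Icc_fracGammaPi hν0 hν1 hβ j] with z hz
  rw [Real.norm_of_nonneg hz.1]
  exact hz.2

lemma integral_ratio_pow_fracGammaPi (hν0 : 0 < ν) (hν1 : ν ≤ 1) (hβ : ∀ i, 0 < β i)
    (j : ι) (k : ℕ) :
    ∫ z, (z j / ∑ i, z i) ^ (k + 1) ∂fracGammaPi β ν = ∫ s in Ioi (0:ℝ), s ^ k / k.factorial *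
        (bernsteinDeriv ν (k + 1) 0 (β j) s * (1 + s ^ ν) ^ (-(∑ i, β i - β j))) := by
  rw [integral_eq_lintegral_of_nonneg_ae _ (Measurable.aestronglyMeasurable (by fun_prop)),
    integral_eq_lintegral_of_nonneg_ae, lintegral_ratio_pow_fracGammaPi hν0 hν1 hβ]
  · filter_upwards [ae_restrict_mem measurableSet_Ioi] with s hs
    have hs : 0 < s := hs
    have := bernsteinDeriv_nonneg hν0.le hν1 (k + 1) le_rfl (hβ j).le hs
    simp only [Pi.zero_apply]
    positivity
  · refine ContinuousOn.aestronglyMeasurable (fun s hs => ContinuousAt.continuousWithinAt ?_)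
      measurableSet_Ioi
    have hs : 0 < s := hs
    have h0 : 0 < 1 + s ^ ν := by positivity
    refine ContinuousAt.mul (by fun_prop)
      ((hasDerivAt_bernsteinDeriv ν (k + 1) 0 (β j) hs).continuousAt.mul ?_)
    exact (continuousAt_const.add (Real.continuousAt_rpow_const _ _ (Or.inl hs.ne'))).rpow_const
      (Or.inl h0.ne')
  · filter_upwards [ae_ratio_mem_Icc_fracGammaPi hν0 hν1 hβ j] with z hz
    exact pow_nonneg hz.1 _

lemma integral_ratio_fracGammaPi (hν0 : 0 < ν) (hν1 : ν ≤ 1) (hβ : ∀ i, 0 < β i) (j : ι) :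
    ∫ z, z j / ∑ i, z i ∂fracGammaPi β ν = β j / ∑ i, β i := by
  have hb : 0 < ∑ i, β i := Finset.sum_pos (fun i _ => hβ i) ⟨j, Finset.mem_univ j⟩
  have h := integral_ratio_pow_fracGammaPi hν0 hν1 hβ j 0
  simp only [zero_add, pow_one] at h
  rw [h, div_eq_mul_one_div,
    ← (integrableOn_and_integral_rpow_mul_one_add_rpow hν0 hb).2, ← integral_const_mul]
  refine setIntegral_congr_fun measurableSet_Ioi fun s hs => ?_
  have hs : 0 < s := hs
  have h0 : 0 < 1 + s ^ ν := by positivity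
  simp only [bernsteinDeriv]
  rw [show -(∑ i, β i + 1) = -(β j + 1) + -(∑ i, β i - β j) by ring, Real.rpow_add h0]
  simp
  ring

lemma integral_ratio_sq_fracGammaPi (hν0 : 0 < ν) (hν1 : ν ≤ 1) (hβ : ∀ i, 0 < β i) (j : ι) :
    ∫ z, (z j / ∑ i, z i) ^ 2 ∂fracGammaPi β ν =
      β j * (1 - ν) * (1 / ∑ i, β i) +
        β j * (β j + 1) * ν * (1 / ((∑ i, β i) * (∑ i, β i + 1))) := by
  have hb : 0 < ∑ i, β i := Finset.sum_pos (fun i _ => hβ i) ⟨j, Finset.mem_univ j⟩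
  have h := integral_ratio_pow_fracGammaPi hν0 hν1 hβ j 1
  obtain ⟨i1, e1⟩ := integrableOn_and_integral_rpow_mul_one_add_rpow hν0 hb
  obtain ⟨i2, e2⟩ := integrableOn_and_integral_rpow_two_mul_one_add_rpow hν0 hb
  rw [h, ← e1, ← e2, ← integral_const_mul, ← integral_const_mul,
    ← integral_add (i1.const_mul _) (i2.const_mul _)]
  refine setIntegral_congr_fun measurableSet_Ioi fun s hs => ?_
  have hs : 0 < s := hs
  have h0 : 0 < 1 + s ^ ν := by positivity
  have r1 : s ^ (ν - 1) = s * s ^ (-(1 - ν + 1)) := by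
    rw [show ν - 1 = 1 + -(1 - ν + 1) by ring, Real.rpow_add hs, Real.rpow_one]
  have r2 : s ^ (2 * ν - 1) = s * s ^ (-(1 - ν + 1 - ν)) := by
    rw [show 2 * ν - 1 = 1 + -(1 - ν + 1 - ν) by ring, Real.rpow_add hs, Real.rpow_one]
  simp only [bernsteinDeriv]
  rw [show -(∑ i, β i + 1) = -(β j + 1) + -(∑ i, β i - β j) by ring, Real.rpow_add h0,
    show -(∑ i, β i + 2) = -(β j + 1 + 1) + -(∑ i, β i - β j) by ring, Real.rpow_add h0, r1, r2]
  simp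
  ring

lemma variance_ratio_fracGammaPi (hν0 : 0 < ν) (hν1 : ν ≤ 1) (hβ : ∀ i, 0 < β i) (j : ι) :
    variance (fun z => z j / ∑ i, z i) (fracGammaPi β ν) =
      β j * ((∑ i, β i) - β j) / ((∑ i, β i) ^ 2 * ((∑ i, β i) + 1)) *
        (1 + (∑ i, β i) * (1 - ν)) := by
  have := isProbabilityMeasure_fracGammaPi hν0 hν1 hβ
  have hb : 0 < ∑ i, β i := Finset.sum_pos (fun i _ => hβ i) ⟨j, Finset.mem_univ j⟩
  rw [variance_eq_sub (memLp_ratio_fracGammaPi hν0 hν1 hβ j 2),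
    integral_ratio_fracGammaPi hν0 hν1 hβ]
  have h := integral_ratio_sq_fracGammaPi hν0 hν1 hβ j
  simp only [Pi.pow_apply]
  rw [h]
  field_simp
  ring

end Moments

/-! ### Integration in polar coordinates on the simplex -/

section PolarCoordinates

variable {n : ℕ}

lemma measurable_completeSimplex :
    Measurable (completeSimplex : (Fin n → ℝ) → Fin (n + 1) → ℝ) := by
  refine measurable_pi_iff.2 fun i => ?_
  refine Fin.lastCases ?_ (fun i => ?_) i
  · simp only [completeSimplex, Fin.snoc_last]; fun_prop
  · simp only [completeSimplex, Fin.snoc_castSucc]; fun_prop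

lemma sum_completeSimplex (q : Fin n → ℝ) : ∑ i, completeSimplex q i = 1 := by
  simp [completeSimplex, Fin.sum_univ_castSucc]

lemma lintegral_eq_lintegral_smul {c : ℝ} (hc : c ≠ 0) {H : (Fin n → ℝ) → ℝ≥0∞}
    (hH : Measurable H) :
    ∫⁻ x, H x = ENNReal.ofReal (|c| ^ n) * ∫⁻ q, H (c • q) := by
  have h := congrArg (fun μ : Measure (Fin n → ℝ) => ∫⁻ x, H x ∂μ)
    (Measure.map_addHaar_smul (volume : Measure (Fin n → ℝ)) hc)
  rw [lintegral_map hH (by fun_prop), lintegral_smul_measure] at h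
  rw [h, smul_eq_mul, ← mul_assoc, ← ENNReal.ofReal_mul (by positivity)]
  have : |c| ^ n * |(c ^ Module.finrank ℝ (Fin n → ℝ))⁻¹| = 1 := by
    have := abs_pos.2 hc
    simp [abs_inv, abs_pow]
    field_simp
  rw [this, ENNReal.ofReal_one, one_mul]

/-- Integration in the coordinates `z = y (q_1, …, q_n, 1 - ∑ q_i)`, that is, `y = ∑ z_i` and
`q_i = z_i / y`. Instead of a Jacobian, a translation in the last coordinate and a scaling in the
others are used. -/
lemma lintegral_eq_lintegral_smul_completeSimplex {F : (Fin (n + 1) → ℝ) → ℝ≥0∞}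
    (hF : Measurable F) :
    ∫⁻ z, F z = ∫⁻ q : Fin n → ℝ, ∫⁻ y : ℝ,
      ENNReal.ofReal (|y| ^ n) * F (y • completeSimplex q) := by
  have hsnoc : Measurable fun p : (Fin n → ℝ) × ℝ =>
      (Fin.snoc (α := fun _ => ℝ) p.1 p.2 : Fin (n + 1) → ℝ) := by
    refine measurable_pi_iff.2 fun i => ?_
    refine Fin.lastCases ?_ (fun i => ?_) i
    · simp only [Fin.snoc_last]; fun_prop
    · simp only [Fin.snoc_castSucc]; fun_prop
  have hcs := measurable_completeSimplex (n := n)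
  have h1 : ∫⁻ z, F z = ∫⁻ x : Fin n → ℝ, ∫⁻ t : ℝ, F (Fin.snoc (α := fun _ => ℝ) x t) := by
    have h := (volume_preserving_piFinSuccAbove (fun _ : Fin (n + 1) => ℝ)
      (Fin.last n)).symm.lintegral_comp hF
    rw [← h, Measure.volume_eq_prod, lintegral_prod_symm _ (by fun_prop)]
    simp [MeasurableEquiv.piFinSuccAbove_symm_apply, Fin.snocEquiv]
  have h2 (x : Fin n → ℝ) : ∫⁻ t : ℝ, F (Fin.snoc (α := fun _ => ℝ) x t) =
      ∫⁻ y : ℝ, F (Fin.snoc (α := fun _ => ℝ) x (y - ∑ i, x i)) :=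
    (lintegral_sub_right_eq_self (fun t => F (Fin.snoc (α := fun _ => ℝ) x t)) _).symm
  have hm : Measurable fun p : (Fin n → ℝ) × ℝ =>
      F (Fin.snoc (α := fun _ => ℝ) p.1 (p.2 - ∑ i, p.1 i)) :=
    hF.comp (hsnoc.comp (f := fun p : (Fin n → ℝ) × ℝ => (p.1, p.2 - ∑ i, p.1 i)) (by fun_prop))
  rw [h1]
  simp_rw [h2]
  rw [lintegral_lintegral_swap hm.aemeasurable]
  conv_rhs => rw [lintegral_lintegral_swap (by fun_prop)]
  refine lintegral_congr_ae ?_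
  filter_upwards [Measure.ae_ne volume (0:ℝ)] with y hy
  rw [lintegral_eq_lintegral_smul (H := fun x => F (Fin.snoc (α := fun _ => ℝ) x (y - ∑ i, x i)))
    hy (hm.comp (measurable_id.prodMk measurable_const)),
    lintegral_const_mul _ (by fun_prop)]
  congr 2 with q
  congr 1
  ext i
  refine Fin.lastCases ?_ (fun i => ?_) i
  · simp [completeSimplex, mul_sub, Finset.mul_sum]
  · simp [completeSimplex]

end PolarCoordinates

/-! ### The fractional Dirichlet law as the law of the normalized variables -/

section FracDirichlet

variable {n : ℕ} {ν : ℝ} {β : Fin (n + 1) → ℝ}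

lemma integrable_fracGammaPDFReal {b : ℝ} (hν0 : 0 < ν) (hν1 : ν ≤ 1) (hb : 0 < b) :
    Integrable (fracGammaPDFReal 1 b ν) := by
  have hm := measurable_fracGammaPDFReal hν0 hb
  refine ⟨hm.aestronglyMeasurable, ?_⟩
  rw [hasFiniteIntegral_iff_ofReal
    (Eventually.of_forall (fracGammaPDFReal_nonneg hν0 hν1 hb))]
  have h := fracGammaMeasure_univ_le_one hν0 hν1 hb
  rw [fracGammaMeasure, withDensity_apply _ MeasurableSet.univ, setLIntegral_univ] at h
  exact h.trans_lt ENNReal.one_lt_top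

lemma fracGammaPi_eq_withDensity (hν0 : 0 < ν) (hν1 : ν ≤ 1) (hβ : ∀ i, 0 < β i) :
    fracGammaPi β ν = volume.withDensity fun z =>
      ENNReal.ofReal (∏ i, fracGammaPDFReal 1 (β i) ν (z i)) := by
  have (i : Fin (n + 1)) := isProbabilityMeasure_fracGammaMeasure hν0 hν1 (hβ i)
  have hnn (i : Fin (n + 1)) (x : ℝ) := fracGammaPDFReal_nonneg hν0 hν1 (hβ i) x
  have hint (i : Fin (n + 1)) := integrable_fracGammaPDFReal hν0 hν1 (hβ i)
  refine Measure.pi_eq fun s hs => ?_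
  have hprod (z : Fin (n + 1) → ℝ) : (univ.pi s).indicator (fun z =>
      ENNReal.ofReal (∏ i, fracGammaPDFReal 1 (β i) ν (z i))) z =
      ENNReal.ofReal (∏ i, (s i).indicator (fracGammaPDFReal 1 (β i) ν) (z i)) := by
    by_cases hz : z ∈ univ.pi s
    · rw [indicator_of_mem hz]
      congr 1
      exact Finset.prod_congr rfl fun i _ => (indicator_of_mem (hz i (mem_univ i)) _).symm
    · rw [indicator_of_notMem hz]
      simp only [mem_univ_pi, not_forall] at hz
      obtain ⟨i, hi⟩ := hz
      rw [Finset.prod_eq_zero (Finset.mem_univ i) (indicator_of_notMem hi _), ENNReal.ofReal_zero]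
  rw [withDensity_apply _ (MeasurableSet.univ_pi hs),
    ← lintegral_indicator (MeasurableSet.univ_pi hs)]
  simp_rw [hprod]
  rw [← ofReal_integral_eq_lintegral_ofReal, volume_pi, integral_fintype_prod_eq_prod
    (fun i => (s i).indicator (fracGammaPDFReal 1 (β i) ν)),
    ENNReal.ofReal_prod_of_nonneg]
  · refine Finset.prod_congr rfl fun i _ => ?_
    rw [integral_indicator (hs i), ofReal_integral_eq_lintegral_ofReal (hint i).integrableOn
      (Eventually.of_forall (hnn i)), fracGammaMeasure, withDensity_apply _ (hs i)]
  · exact fun i _ => integral_nonneg fun x => indicator_nonneg (fun x _ => hnn i x) x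
  · exact Integrable.fintype_prod_dep (f := fun i => (s i).indicator (fracGammaPDFReal 1 (β i) ν))
      fun i => (hint i).indicator (hs i)
  · exact Eventually.of_forall fun z =>
      Finset.prod_nonneg fun i _ => indicator_nonneg (fun x _ => hnn i x) _

/-- All normalized coordinates `z_i / ∑ z` but the last one. -/
noncomputable def normalizeInit (z : Fin (n + 1) → ℝ) : Fin n → ℝ :=
  fun i => z i.castSucc / ∑ k, z k

lemma measurable_normalizeInit : Measurable (normalizeInit (n := n)) := by
  unfold normalizeInit; fun_prop

lemma completeSimplex_normalizeInit {z : Fin (n + 1) → ℝ} (hz : ∑ i, z i ≠ 0) (j : Fin (n + 1)) :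
    completeSimplex (normalizeInit z) j = z j / ∑ i, z i := by
  refine Fin.lastCases ?_ (fun j => ?_) j
  · simp only [completeSimplex, Fin.snoc_last, normalizeInit]
    rw [← Finset.sum_div, eq_div_iff hz, sub_mul, div_mul_cancel₀ _ hz,
      Fin.sum_univ_castSucc z]
    ring
  · simp [completeSimplex, normalizeInit]

lemma normalizeInit_smul_completeSimplex (q : Fin n → ℝ) {y : ℝ} (hy : y ≠ 0) :
    normalizeInit (y • completeSimplex q) = q := by
  ext i
  simp only [normalizeInit, Pi.smul_apply, smul_eq_mul, ← Finset.mul_sum, sum_completeSimplex]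
  simp [completeSimplex, hy]

lemma completeSimplex_pos {q : Fin n → ℝ} (hq : q ∈ openSimplex n) (i : Fin (n + 1)) :
    0 < completeSimplex q i := by
  refine Fin.lastCases ?_ (fun i => ?_) i
  · simp only [completeSimplex, Fin.snoc_last]; linarith [hq.2]
  · simpa [completeSimplex] using hq.1 i

lemma mem_openSimplex_of_pos {q : Fin n → ℝ} (hq : ∀ i, 0 < completeSimplex q i) :
    q ∈ openSimplex n := by
  refine ⟨fun i => by simpa [completeSimplex] using hq i.castSucc, ?_⟩
  have := hq (Fin.last n)
  simp only [completeSimplex, Fin.snoc_last] at this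
  linarith

/-- The integrand of the fractional Dirichlet density is the joint density of independent
fractional Gamma variables at `y q`, times the Jacobian `y ^ n`. -/
lemma pow_mul_prod_fracGammaPDFReal {q : Fin n → ℝ} (hq : q ∈ openSimplex n) {y : ℝ} (hy : 0 < y) :
    y ^ n * ∏ i, fracGammaPDFReal 1 (β i) ν (y * completeSimplex q i) =
      (∏ i, completeSimplex q i ^ (ν * β i - 1)) * (y ^ (ν * (∑ i, β i) - 1) *
        ∏ i, mittagLeffler3 ν (ν * β i) (β i) (-(y * completeSimplex q i) ^ ν)) := by
  have hp := completeSimplex_pos hq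
  have h1 (i : Fin (n + 1)) : fracGammaPDFReal 1 (β i) ν (y * completeSimplex q i) =
      y ^ (ν * β i - 1) * completeSimplex q i ^ (ν * β i - 1) *
        mittagLeffler3 ν (ν * β i) (β i) (-(y * completeSimplex q i) ^ ν) := by
    rw [fracGammaPDFReal, if_pos (mul_pos hy (hp i)), Real.mul_rpow hy.le (hp i).le]
    simp
  have h2 : y ^ n * ∏ i, y ^ (ν * β i - 1) = y ^ (ν * (∑ i, β i) - 1) := by
    rw [← Real.rpow_sum_of_pos hy, ← Real.rpow_natCast, ← Real.rpow_add hy,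
      Finset.sum_sub_distrib, Finset.mul_sum]
    simp only [Finset.sum_const, Finset.card_univ, Fintype.card_fin, nsmul_eq_mul, mul_one]
    congr 1
    push_cast
    ring
  simp_rw [h1, Finset.prod_mul_distrib, ← h2]
  ring

/-- The fractional Dirichlet law is the law of the normalized independent fractional Gamma
variables. -/
lemma map_normalizeInit_fracGammaPi (hν0 : 0 < ν) (hν1 : ν ≤ 1) (hβ : ∀ i, 0 < β i) :
    (fracGammaPi β ν).map normalizeInit = fracDirichletMeasure β ν := by
  have := isProbabilityMeasure_fracGammaPi hν0 hν1 hβ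
  have hfm (i : Fin (n + 1)) := measurable_fracGammaPDFReal hν0 (hβ i)
  have hnn (i : Fin (n + 1)) (x : ℝ) := fracGammaPDFReal_nonneg hν0 hν1 (hβ i) x
  have hcs := measurable_completeSimplex (n := n)
  have hcsi (i : Fin (n + 1)) : Measurable fun q : Fin n → ℝ => completeSimplex q i :=
    (measurable_pi_apply i).comp hcs
  have hN := measurable_normalizeInit (n := n)
  -- the density of the law of the normalized vector
  set D : (Fin n → ℝ) → ℝ≥0∞ := fun q => ∫⁻ y : ℝ, ENNReal.ofReal (|y| ^ n) *
    ENNReal.ofReal (∏ i, fracGammaPDFReal 1 (β i) ν (y * completeSimplex q i)) with hD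
  have hDm : Measurable D := by
    have : Measurable fun p : (Fin n → ℝ) × ℝ => ENNReal.ofReal (|p.2| ^ n) *
        ENNReal.ofReal (∏ i, fracGammaPDFReal 1 (β i) ν (p.2 * completeSimplex p.1 i)) := by
      fun_prop
    exact this.lintegral_prod_right'
  have hmap {g : (Fin n → ℝ) → ℝ≥0∞} (hg : Measurable g) :
      ∫⁻ q, g q ∂(fracGammaPi β ν).map normalizeInit = ∫⁻ q, D q * g q := by
    rw [lintegral_map hg hN, fracGammaPi_eq_withDensity hν0 hν1 hβ,
      lintegral_withDensity_eq_lintegral_mul _ (by fun_prop)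
        (show Measurable fun z => g (normalizeInit z) from hg.comp hN),
      lintegral_eq_lintegral_smul_completeSimplex (by fun_prop)]
    refine lintegral_congr fun q => ?_
    rw [hD, ← lintegral_mul_const _ (by fun_prop)]
    refine lintegral_congr_ae ?_
    filter_upwards [Measure.ae_ne volume (0:ℝ)] with y hy
    simp only [Pi.mul_apply, normalizeInit_smul_completeSimplex q hy,
      Pi.smul_apply, smul_eq_mul, mul_assoc]
  -- `D` is the density of a probability measure, so that the Bochner integral in the definition of
  -- the fractional Dirichlet density is that of an integrable function for almost every `q`
  have hDfin : ∀ᵐ q, D q < ∞ := by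
    refine ae_lt_top hDm ?_
    have h := hmap (g := fun _ => 1) measurable_const
    have := Measure.isProbabilityMeasure_map (μ := fracGammaPi β ν) hN.aemeasurable
    simp only [lintegral_one, measure_univ, mul_one] at h
    rw [← h]
    exact ENNReal.one_ne_top
  have hDeq : D =ᵐ[volume] fun q => ENNReal.ofReal (fracDirichletPDFReal β ν q) := by
    filter_upwards [hDfin] with q hq
    -- outside `y > 0`, `q` in the simplex, some factor of the joint density vanishes
    have hzero (y : ℝ) (h : ¬ ∀ i, 0 < y * completeSimplex q i) :
        ENNReal.ofReal (|y| ^ n) *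
          ENNReal.ofReal (∏ i, fracGammaPDFReal 1 (β i) ν (y * completeSimplex q i)) = 0 := by
      obtain ⟨i, hi⟩ := not_forall.1 h
      rw [Finset.prod_eq_zero (Finset.mem_univ i) (by rw [fracGammaPDFReal, if_neg hi])]
      simp
    have hypos (y : ℝ) (h : ∀ i, 0 < y * completeSimplex q i) : 0 < y := by
      have := Finset.sum_pos (fun i _ => h i) Finset.univ_nonempty
      rwa [← Finset.mul_sum, sum_completeSimplex, mul_one] at this
    by_cases hqS : q ∈ openSimplex n
    · have hDq : D q = ∫⁻ y in Ioi (0:ℝ), ENNReal.ofReal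
          ((∏ i, completeSimplex q i ^ (ν * β i - 1)) * (y ^ (ν * (∑ i, β i) - 1) *
            ∏ i, mittagLeffler3 ν (ν * β i) (β i) (-(y * completeSimplex q i) ^ ν))) := by
        rw [← lintegral_indicator measurableSet_Ioi]
        refine lintegral_congr fun y => ?_
        by_cases hy : 0 < y
        · rw [indicator_of_mem (mem_Ioi.2 hy), ← pow_mul_prod_fracGammaPDFReal hqS hy,
            abs_of_pos hy, ENNReal.ofReal_mul (by positivity)]
        · rw [indicator_of_notMem (by simpa using hy), hzero y fun h => hy (hypos y h)]
      have hnonneg : 0 ≤ᵐ[volume.restrict (Ioi 0)] fun y : ℝ =>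
          (∏ i, completeSimplex q i ^ (ν * β i - 1)) * (y ^ (ν * (∑ i, β i) - 1) *
            ∏ i, mittagLeffler3 ν (ν * β i) (β i) (-(y * completeSimplex q i) ^ ν)) := by
        filter_upwards [ae_restrict_mem measurableSet_Ioi] with y hy
        have hy : 0 < y := hy
        rw [Pi.zero_apply, ← pow_mul_prod_fracGammaPDFReal hqS hy]
        exact mul_nonneg (by positivity) (Finset.prod_nonneg fun i _ => hnn i _)
      rw [fracDirichletPDFReal, if_pos hqS, ← integral_const_mul,
        ofReal_integral_eq_lintegral_ofReal _ hnonneg, hDq]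
      refine ⟨?_, ?_⟩
      · have hml (i : Fin (n + 1)) :
            Measurable (mittagLeffler3 ν (ν * β i) (β i)) :=
          (continuous_mittagLeffler3 hν0 (hβ i)).measurable
        exact Measurable.aestronglyMeasurable (by fun_prop)
      · rw [hasFiniteIntegral_iff_ofReal hnonneg, ← hDq]
        exact hq
    · rw [fracDirichletPDFReal, if_neg hqS, ENNReal.ofReal_zero, hD]
      simp only
      rw [lintegral_congr fun y => hzero y fun h => hqS (mem_openSimplex_of_pos fun i =>
        (pos_iff_pos_of_mul_pos (h i)).1 (hypos y h)), lintegral_zero]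
  rw [fracDirichletMeasure, ← withDensity_congr_ae hDeq]
  refine Measure.ext_of_lintegral _ fun g hg => ?_
  rw [hmap hg, lintegral_withDensity_eq_lintegral_mul _ hDm hg]
  rfl

/-- For `ν = 1` the Prabhakar function is an exponential. -/
lemma mittagLeffler3_one {b : ℝ} (hb : 0 < b) (x : ℝ) :
    mittagLeffler3 1 (1 * b) b x = Real.exp x / Real.Gamma b := by
  have h1 : (fun r : ℕ => x ^ r / Real.Gamma (1 * r + 1 * b) *
      (Real.Gamma (b + r) / ((r.factorial : ℝ) * Real.Gamma b))) =
      fun r : ℕ => x ^ r / r.factorial / Real.Gamma b := by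
    ext r
    have h2 : Real.Gamma (b + r) ≠ 0 := (Real.Gamma_pos_of_pos (by positivity)).ne'
    have h3 : Real.Gamma b ≠ 0 := (Real.Gamma_pos_of_pos hb).ne'
    rw [one_mul, one_mul, add_comm (r : ℝ) b]
    field_simp
  rw [mittagLeffler3, h1, tsum_div_const, Real.exp_eq_exp_ℝ,
    NormedSpace.exp_eq_tsum_div]

lemma dirichletMeasure_eq_fracDirichletMeasure (hβ : ∀ i, 0 < β i) :
    dirichletMeasure β = fracDirichletMeasure β 1 := by
  rw [dirichletMeasure, fracDirichletMeasure]
  congr with q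
  rw [dirichletPDFReal, fracDirichletPDFReal]
  split_ifs with hq
  · have hb : 0 < ∑ i, β i := Finset.sum_pos (fun i _ => hβ i) Finset.univ_nonempty
    have h1 (y : ℝ) : ∏ i, mittagLeffler3 1 (1 * β i) (β i) (-(y * completeSimplex q i) ^ (1:ℝ)) =
        Real.exp (-(1 * y)) / ∏ i, Real.Gamma (β i) := by
      simp_rw [mittagLeffler3_one (hβ _), Real.rpow_one, Finset.prod_div_distrib, ← Real.exp_sum,
        Finset.sum_neg_distrib, ← Finset.mul_sum, sum_completeSimplex, mul_one, one_mul]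
    simp_rw [h1, mul_div_assoc', one_mul (∑ i, β i)]
    rw [integral_div, Real.integral_rpow_mul_exp_neg_mul_Ioi hb one_pos]
    simp [mul_comm (Real.Gamma _ / _)]
  · rfl

end FracDirichlet

/-! ### Comparison with the Dirichlet law -/

section Comparison

variable {n : ℕ} {ν : ℝ} {β : Fin (n + 1) → ℝ}

lemma variance_completeSimplex_fracDirichletMeasure (hν0 : 0 < ν) (hν1 : ν ≤ 1)
    (hβ : ∀ i, 0 < β i) (j : Fin (n + 1)) :
    variance (fun q => completeSimplex q j) (fracDirichletMeasure β ν) =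
      β j * ((∑ i, β i) - β j) / ((∑ i, β i) ^ 2 * ((∑ i, β i) + 1)) *
        (1 + (∑ i, β i) * (1 - ν)) := by
  have hcs : Measurable fun q : Fin n → ℝ => completeSimplex q j :=
    (measurable_pi_apply j).comp measurable_completeSimplex
  rw [← map_normalizeInit_fracGammaPi hν0 hν1 hβ,
    variance_map hcs.aemeasurable measurable_normalizeInit.aemeasurable,
    ← variance_ratio_fracGammaPi hν0 hν1 hβ j]
  refine variance_congr ?_
  filter_upwards [ae_pos_fracGammaPi hν0 hν1 hβ] with z hz
  exact completeSimplex_normalizeInit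
    (Finset.sum_pos (fun i _ => hz i) Finset.univ_nonempty).ne' j

lemma variance_completeSimplex_dirichletMeasure (hβ : ∀ i, 0 < β i) (j : Fin (n + 1)) :
    variance (fun q => completeSimplex q j) (dirichletMeasure β) =
      β j * ((∑ i, β i) - β j) / ((∑ i, β i) ^ 2 * ((∑ i, β i) + 1)) := by
  rw [dirichletMeasure_eq_fracDirichletMeasure hβ,
    variance_completeSimplex_fracDirichletMeasure one_pos le_rfl hβ]
  simp

lemma dirichlet_variance_le_mul (hν1 : ν ≤ 1) (hβ : ∀ i, 0 < β i) (j : Fin (n + 1)) :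
    β j * ((∑ i, β i) - β j) / ((∑ i, β i) ^ 2 * ((∑ i, β i) + 1)) ≤
      β j * ((∑ i, β i) - β j) / ((∑ i, β i) ^ 2 * ((∑ i, β i) + 1)) *
        (1 + (∑ i, β i) * (1 - ν)) := by
  have hb : 0 < ∑ i, β i := Finset.sum_pos (fun i _ => hβ i) Finset.univ_nonempty
  have hj := hβ j
  have hle : 0 ≤ ∑ i, β i - β j :=
    sub_nonneg.2 (Finset.single_le_sum (fun i _ => (hβ i).le) (Finset.mem_univ j))
  refine le_mul_of_one_le_right (by positivity) ?_
  have := mul_nonneg hb.le (sub_nonneg.2 hν1)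
  linarith

lemma dirichlet_variance_lt_mul (hν1 : ν < 1) (hn : 0 < n) (hβ : ∀ i, 0 < β i)
    (j : Fin (n + 1)) :
    β j * ((∑ i, β i) - β j) / ((∑ i, β i) ^ 2 * ((∑ i, β i) + 1)) <
      β j * ((∑ i, β i) - β j) / ((∑ i, β i) ^ 2 * ((∑ i, β i) + 1)) *
        (1 + (∑ i, β i) * (1 - ν)) := by
  have hb : 0 < ∑ i, β i := Finset.sum_pos (fun i _ => hβ i) Finset.univ_nonempty
  have hj := hβ j
  have : Nontrivial (Fin (n + 1)) := Fin.nontrivial_iff_two_le.2 (by omega)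
  obtain ⟨k, hk⟩ := exists_ne j
  have hlt : 0 < ∑ i, β i - β j :=
    sub_pos.2 (Finset.single_lt_sum hk (Finset.mem_univ j) (Finset.mem_univ k) (hβ k)
      fun i _ _ => (hβ i).le)
  refine lt_mul_of_one_lt_right (by positivity) ?_
  have := mul_pos hb (sub_pos.2 hν1)
  linarith

end Comparison

theorem mainTheorem2 {n : ℕ} (β : Fin (n + 1) → ℝ) (hβ : ∀ i, 0 < β i)
    (ν : ℝ) (hν0 : 0 < ν) (hν1 : ν ≤ 1)
    {Ω : Type*} [MeasurableSpace Ω] (P : Measure Ω) [IsProbabilityMeasure P] :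
    -- normalized independent fractional Gamma variables
    (∀ Z : Fin (n + 1) → Ω → ℝ,
      (∀ i, HasLaw (Z i) (fracGammaMeasure 1 (β i) ν) P) → iIndepFun Z P →
      ∀ j : Fin (n + 1),
        MemLp (fun ω => Z j ω / ∑ i, Z i ω) 2 P ∧
        ∫ ω, Z j ω / ∑ i, Z i ω ∂P = β j / ∑ i, β i ∧
        variance (fun ω => Z j ω / ∑ i, Z i ω) P =
          β j * ((∑ i, β i) - β j) / ((∑ i, β i) ^ 2 * ((∑ i, β i) + 1)) *
            (1 + (∑ i, β i) * (1 - ν)) ∧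
        variance (fun q => completeSimplex q j) (dirichletMeasure β) ≤
          variance (fun ω => Z j ω / ∑ i, Z i ω) P ∧
        (ν < 1 → 0 < n → variance (fun q => completeSimplex q j) (dirichletMeasure β) <
          variance (fun ω => Z j ω / ∑ i, Z i ω) P)) ∧
    -- random vectors with the fractional Dirichlet density
    (∀ Q : Ω → Fin n → ℝ, HasLaw Q (fracDirichletMeasure β ν) P →
      ∀ j : Fin n,
        MemLp (fun ω => Q ω j) 2 P ∧
        ∫ ω, Q ω j ∂P = β j.castSucc / ∑ i, β i ∧
        variance (fun ω => Q ω j) P =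
          β j.castSucc * ((∑ i, β i) - β j.castSucc) /
              ((∑ i, β i) ^ 2 * ((∑ i, β i) + 1)) *
            (1 + (∑ i, β i) * (1 - ν)) ∧
        variance (fun q => q j) (dirichletMeasure β) ≤ variance (fun ω => Q ω j) P ∧
        (ν < 1 →
          variance (fun q => q j) (dirichletMeasure β) < variance (fun ω => Q ω j) P)) ∧
    -- the first factor of the variance is the variance of the Dirichlet marginal
    (∀ j : Fin (n + 1),
      variance (fun q => completeSimplex q j) (dirichletMeasure β) =
        β j * ((∑ i, β i) - β j) / ((∑ i, β i) ^ 2 * ((∑ i, β i) + 1))) := by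
  refine ⟨fun Z hZ hind j => ?_, fun Q hQ j => ?_, variance_completeSimplex_dirichletMeasure hβ⟩
  · have hlaw : HasLaw (fun ω i => Z i ω) (fracGammaPi β ν) P := by
      refine ⟨aemeasurable_pi_lambda _ fun i => (hZ i).aemeasurable, ?_⟩
      rw [hind.map_fun_eq_pi_map fun i => (hZ i).aemeasurable]
      simp_rw [fun i => (hZ i).map_eq]
      rfl
    have hm : Measurable fun z : Fin (n + 1) → ℝ => z j / ∑ i, z i := by fun_prop
    have hvar : variance (fun ω => Z j ω / ∑ i, Z i ω) P =
        β j * ((∑ i, β i) - β j) / ((∑ i, β i) ^ 2 * ((∑ i, β i) + 1)) *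
          (1 + (∑ i, β i) * (1 - ν)) := by
      rw [← variance_ratio_fracGammaPi hν0 hν1 hβ j, ← hlaw.map_eq,
        variance_map hm.aemeasurable hlaw.aemeasurable]
      rfl
    refine ⟨?_, ?_, hvar, ?_, fun hν hn => ?_⟩
    · have := memLp_ratio_fracGammaPi hν0 hν1 hβ j 2
      rw [← hlaw.map_eq, memLp_map_measure_iff hm.aestronglyMeasurable hlaw.aemeasurable] at this
      exact this
    · rw [← integral_ratio_fracGammaPi hν0 hν1 hβ j, ← hlaw.map_eq,
        integral_map hlaw.aemeasurable hm.aestronglyMeasurable]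
    · rw [hvar, variance_completeSimplex_dirichletMeasure hβ]
      exact dirichlet_variance_le_mul hν1 hβ j
    · rw [hvar, variance_completeSimplex_dirichletMeasure hβ]
      exact dirichlet_variance_lt_mul hν hn hβ j
  · have hm : Measurable fun q : Fin n → ℝ => q j := measurable_pi_apply j
    have hN := measurable_normalizeInit (n := n)
    have hcs (q : Fin n → ℝ) : q j = completeSimplex q j.castSucc := by simp [completeSimplex]
    have hmap := map_normalizeInit_fracGammaPi hν0 hν1 hβ
    have hvar : variance (fun ω => Q ω j) P =
        β j.castSucc * ((∑ i, β i) - β j.castSucc) / ((∑ i, β i) ^ 2 * ((∑ i, β i) + 1)) *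
          (1 + (∑ i, β i) * (1 - ν)) := by
      rw [← variance_completeSimplex_fracDirichletMeasure hν0 hν1 hβ j.castSucc, ← hQ.map_eq]
      simp_rw [← hcs]
      rw [variance_map hm.aemeasurable hQ.aemeasurable]
      rfl
    have hD : variance (fun q => q j) (dirichletMeasure β) =
        β j.castSucc * ((∑ i, β i) - β j.castSucc) / ((∑ i, β i) ^ 2 * ((∑ i, β i) + 1)) := by
      simp_rw [hcs]
      exact variance_completeSimplex_dirichletMeasure hβ j.castSucc
    refine ⟨?_, ?_, hvar, ?_, fun hν => ?_⟩
    · have := memLp_ratio_fracGammaPi hν0 hν1 hβ j.castSucc 2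
      have h2 : MemLp (fun q : Fin n → ℝ => q j) 2 (P.map Q) := by
        rw [hQ.map_eq, ← hmap, memLp_map_measure_iff hm.aestronglyMeasurable hN.aemeasurable]
        exact this
      rwa [memLp_map_measure_iff hm.aestronglyMeasurable hQ.aemeasurable] at h2
    · have h2 := integral_map (μ := P) hQ.aemeasurable hm.aestronglyMeasurable
      rw [← h2, hQ.map_eq, ← hmap, integral_map hN.aemeasurable hm.aestronglyMeasurable,
        ← integral_ratio_fracGammaPi hν0 hν1 hβ j.castSucc]
      rfl
    · rw [hvar, hD]
      exact dirichlet_variance_le_mul hν1 hβ j.castSucc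
    · rw [hvar, hD]
      exact dirichlet_variance_lt_mul hν (j.pos) hβ j.castSucc
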